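/- **The parking model on $\mathbb{Z}$.** Let $p\in[0,1]$. Under $\mathbb{P}_p$, each vertex $v\in\mathbb{Z}$ is, independently, initially occupied by a car with probability $p$, and by a vacant parking spot with probability $1-p$. Each vertex $v$ also carries a simple symmetric random walk $(X^{v}_n)_{n\ge0}$ on $\mathbb{Z}$ started at $v$ and a sequence $(U^{v}_n)_{n\ge 0}$ of i.i.d. uniform $[0,1]$ variables, all these objects being independent. At each integer time $n\ge1$, every car that started at some $v$ and is still unparked moves to $X^{v}_n$. If one or more cars move at time $n$ to a site with a vacant spot, then the one among them with the largest value of $U^{v}_n$ parks there forever, and the spot is no longer vacant; all other moving cars remain unparked and keep following their walks. Let $\sigma$ be the time at which a car parks in the spot at the origin, with $\sigma=0$ if there is initially no spot at the origin, and $\sigma=\infty$ if there is one but no car ever parks in it. **Theorem 1.2.** Let $1/2<p\le1$. There exists a constant $b=b(p)>0$ such that $$\mathbb{P}_p(\sigma>t)\le e^{-b\sqrt t}\qquad\text{for all real } t\ge1,$$ and, if moreover $p<1$, there exists a constant $a=a(p)>0$ such that $$e^{-a\sqrt t}\le\mathbb{P}_p(\sigma>t)\qquad\text{for all real } t\ge1.$$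 -/

import Mathlib

open MeasureTheory

open scoped ENNReal

noncomputable section

namespace Parking

/-- The law on `{-1, 1}` (the units of `ℤ`) with mass `q` at `1` and mass `1 - q` at `-1`. -/
def signLaw (q : unitInterval) : Measure ℤˣ :=
  ENNReal.ofReal (q : ℝ) • Measure.dirac 1 + ENNReal.ofReal (1 - (q : ℝ)) • Measure.dirac (-1)

instance signLaw_isProbabilityMeasure (q : unitInterval) : IsProbabilityMeasure (signLaw q) := by
  constructor
  have h0 : (0 : ℝ) ≤ q := q.2.1
  have h1 : (0 : ℝ) ≤ 1 - (q : ℝ) := sub_nonneg.2 q.2.2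
  simp [signLaw, ← ENNReal.ofReal_add h0 h1]

/-- The parameter `1/2`, as an element of `[0, 1]`. -/
def half : unitInterval := ⟨1 / 2, by norm_num, by norm_num⟩

/-- The randomness attached to one vertex: the type of the vertex (`1` for a car, `-1` for a vacant
parking spot), the successive `±1` steps of the walk of the vertex, and the tie-breaking marks. -/
abbrev Site : Type := ℤˣ × (ℕ → ℤˣ) × (ℕ → unitInterval)

/-- The configuration space of the parking model on `ℤ`. -/
abbrev Config : Type := ℤ → Site

/-- The law of the randomness of one vertex: the type is a car with probability `p`, the steps are
i.i.d. uniform on `{-1, 1}`, the marks are i.i.d. uniform on `[0, 1]`, and all are independent. -/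
def siteLaw (p : unitInterval) : Measure Site :=
  (signLaw p).prod
    ((Measure.infinitePi fun _ : ℕ => signLaw half).prod
      (Measure.infinitePi fun _ : ℕ => (volume : Measure unitInterval)))

instance siteLaw_isProbabilityMeasure (p : unitInterval) : IsProbabilityMeasure (siteLaw p) := by
  unfold siteLaw; infer_instance

/-- The measure `ℙ_p` of the parking model on `ℤ`: distinct vertices are independent. -/
def parkingLaw (p : unitInterval) : Measure Config :=
  Measure.infinitePi fun _ : ℤ => siteLaw p

/-- A car is initially placed at `v`. -/
def IsCar (ω : Config) (v : ℤ) : Prop := (ω v).1 = 1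

/-- A vacant parking spot is initially placed at `v`. -/
def IsSpot (ω : Config) (v : ℤ) : Prop := (ω v).1 = -1

/-- The position at time `n` of the simple symmetric random walk started at `v`; an unparked car
with starting point `v` follows this path. -/
def walk (ω : Config) (v : ℤ) (n : ℕ) : ℤ := v + ∑ i ∈ Finset.range n, (((ω v).2.1 i : ℤˣ) : ℤ)

/-- The tie-breaking mark, for time `n`, of the car with starting point `v`. -/
def mark (ω : Config) (v : ℤ) (n : ℕ) : unitInterval := (ω v).2.2 n

/-- The state of the process at a given time. Cars are named by their starting points. -/
structure State where
  /-- The (names of the) cars that are not parked. -/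
  unparked : Set ℤ
  /-- The locations of the vacant parking spots. -/
  vacant : Set ℤ

/-- Given the state `S` at time `n - 1`, the car named `v` parks at time `n`: it is unparked, its
step at time `n` takes it to a vacant spot, and among all unparked cars that step to this spot at
time `n` it has the largest mark for time `n`. -/
def ParksFrom (ω : Config) (S : State) (n : ℕ) (v : ℤ) : Prop :=
  v ∈ S.unparked ∧ walk ω v n ∈ S.vacant ∧
    ∀ u ∈ S.unparked, u ≠ v → walk ω u n = walk ω v n → mark ω u n < mark ω v n

/-- The state of the parking process at time `n`. -/
def state (ω : Config) : ℕ → State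
  | 0 => ⟨{v | IsCar ω v}, {x | IsSpot ω x}⟩
  | n + 1 =>
    ⟨{v | v ∈ (state ω n).unparked ∧ ¬ ParksFrom ω (state ω n) (n + 1) v},
      {x | x ∈ (state ω n).vacant ∧
        ¬ ∃ v, ParksFrom ω (state ω n) (n + 1) v ∧ walk ω v (n + 1) = x}⟩

/-- At time `n + 1` some car parks in the spot at `x`. -/
def FilledAt (ω : Config) (x : ℤ) (n : ℕ) : Prop :=
  ∃ v, ParksFrom ω (state ω n) (n + 1) v ∧ walk ω v (n + 1) = x

open Classical in
/-- The time `σ` at which the parking spot at the origin is parked in by a car: it is `0` if there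
is no spot at the origin, and `∞` if there is one in which no car ever parks. -/
def sigma (ω : Config) : ℕ∞ :=
  if IsSpot ω 0 then ⨅ (n : ℕ) (_ : FilledAt ω 0 n), ((n + 1 : ℕ) : ℕ∞) else 0

end Parking

end

/-! Since `sigma` takes values in the nonnegative integers and `∞`, the event that it exceeds `t`
says that the origin is vacant at time `⌊t⌋₊` (`lt_sigma_iff`). So both bounds concern the
probability of vacancy at a fixed time.

Upper bound. Write `δ = 2p - 1`. Every parked car uses up its own spot, so at all times a given
vertex has probability at least `δ` of being the start of an unparked car
(`le_measureReal_unparked`). This forces the vacancy probability to tend to zero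
(`exists_measureReal_vacant_le`): if it stayed above `ε`, a long interval would keep many vacant
spots for a long time, while the walk from a nearby vertex would eventually cross the whole
interval, and its car could not still be unparked.

Now fix a time `s` with a very small vacancy probability. Of the cars starting in `[1, M]`, a
surplus of order `δM` is unparked at time `s`. Most of their walks reach the origin within a time of
order `M ^ 2` without leaving `[0, K]`, where `K` is a multiple of `M`. If the origin is still
vacant then, these cars have parked in distinct spots of `[1, K]` vacant at time `s`, and there are
too few of those (`notMem_vacant_of_card_lt`). Each failure is a deviation of a count of local
events, exponentially unlikely in `M` by Hoeffding (`infinitePi_card_ge_le`). Time of order `M ^ 2`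
turns this into `exp (-b√t)`.

Lower bound. Require only spots within distance of order `√t` of the origin, and require that no
walk from further out visits the origin by time `t`. The first costs a factor exponential in `√t`.
By Kolmogorov's inequality the walk from `x` fails with probability at most `t / x ^ 2`, and these
sum to order `√t`, so by independence the second costs a similar factor
(`exp_neg_le_measureReal_vacant`). -/

noncomputable section

open ProbabilityTheory

namespace Parking

/-! ### Independence of events on disjoint finite sets of coordinates -/

section Independence

variable {ι : Type*} {X : ι → Type*}

/-- Extend a family defined on a finset by the values of a reference family. -/
def extendBy (x₀ : ∀ i, X i) (S : Finset ι) (x : ∀ i : S, X i) : ∀ i, X i :=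
  open Classical in fun i => if h : i ∈ S then x ⟨i, h⟩ else x₀ i

lemma measurable_extendBy [∀ i, MeasurableSpace (X i)] (x₀ : ∀ i, X i) (S : Finset ι) : Measurable (extendBy x₀ S) := by
  refine measurable_pi_lambda _ fun i => ?_
  unfold extendBy
  by_cases h : i ∈ S
  · simp only [h, dite_true]
    exact measurable_pi_apply _
  · simp only [h, dite_false]
    exact measurable_const

lemma preimage_restrict_extendBy (x₀ : ∀ i, X i) {S : Finset ι} {A : Set (∀ i, X i)}
    (hA : DependsOn (fun x => x ∈ A) S) : S.restrict ⁻¹' (extendBy x₀ S ⁻¹' A) = A := by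
  ext x
  have : extendBy x₀ S (S.restrict x) ∈ A ↔ x ∈ A := by
    refine iff_of_eq (hA fun i hi => ?_)
    have hi' : i ∈ S := hi
    simp [extendBy, hi']
  exact this

variable [∀ i, MeasurableSpace (X i)] (μ : ∀ i, Measure (X i)) [∀ i, IsProbabilityMeasure (μ i)]

/-- An event that depends only on `S` is recovered from the restriction to `S` by filling in
reference values elsewhere, so independence of finite blocks of coordinates applies to it. -/
lemma infinitePi_inter_of_dependsOn {S T : Finset ι} (hST : Disjoint S T)
    {A B : Set (∀ i, X i)} (hA : MeasurableSet A) (hB : MeasurableSet B)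
    (dA : DependsOn (fun x => x ∈ A) S) (dB : DependsOn (fun x => x ∈ B) T) :
    Measure.infinitePi μ (A ∩ B) = Measure.infinitePi μ A * Measure.infinitePi μ B := by
  have x₀ : ∀ i, X i := fun i => (nonempty_of_isProbabilityMeasure (μ i)).some
  have hind : iIndepFun (fun (i : ι) (x : ∀ i, X i) => x i) (Measure.infinitePi μ) :=
    iIndepFun_infinitePi (X := fun _ x => x) (fun i => measurable_id)
  have h2 := hind.indepFun_finset S T hST (fun i => measurable_pi_apply i)
  have := h2.measure_inter_preimage_eq_mul _ _ (measurable_extendBy x₀ S hA)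
    (measurable_extendBy x₀ T hB)
  have eA := preimage_restrict_extendBy x₀ dA
  have eB := preimage_restrict_extendBy x₀ dB
  change Measure.infinitePi μ (S.restrict ⁻¹' (extendBy x₀ S ⁻¹' A) ∩
    T.restrict ⁻¹' (extendBy x₀ T ⁻¹' B)) = Measure.infinitePi μ (S.restrict ⁻¹' (extendBy x₀ S ⁻¹' A)) *
    Measure.infinitePi μ (T.restrict ⁻¹' (extendBy x₀ T ⁻¹' B)) at this
  rwa [eA, eB] at this

lemma indepFun_of_dependsOn {Y Z : Type*} [MeasurableSpace Y] [MeasurableSpace Z] {S T : Finset ι}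
    (hST : Disjoint S T) {f : (∀ i, X i) → Y} {g : (∀ i, X i) → Z} (hf : Measurable f)
    (hg : Measurable g) (df : DependsOn f S) (dg : DependsOn g T) :
    IndepFun f g (Measure.infinitePi μ) := by
  rw [indepFun_iff_measure_inter_preimage_eq_mul]
  intro s t hs ht
  refine infinitePi_inter_of_dependsOn μ hST (hf hs) (hg ht) ?_ ?_
  · intro x y hxy
    simp only [Set.mem_preimage, df hxy]
  · intro x y hxy
    simp only [Set.mem_preimage, dg hxy]

lemma iIndepFun_of_dependsOn {κ Y : Type*} [MeasurableSpace Y] {S : κ → Finset ι}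
    (hS : Pairwise fun j k => Disjoint (S j) (S k)) {f : κ → (∀ i, X i) → Y}
    (hf : ∀ k, Measurable (f k)) (df : ∀ k, DependsOn (f k) (S k)) :
    iIndepFun f (Measure.infinitePi μ) := by
  classical
  rw [iIndepFun_iff_measure_inter_preimage_eq_mul]
  intro s sets hsets
  induction s using Finset.induction_on with
  | empty => simp
  | insert k s hk ih =>
    have ih' := ih fun i hi => hsets i (Finset.mem_insert_of_mem hi)
    rw [Finset.prod_insert hk, ← ih', Finset.set_biInter_insert]
    refine infinitePi_inter_of_dependsOn μ (S := S k) (T := s.biUnion S) ?_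
      (hf k (hsets k (Finset.mem_insert_self _ _))) ?_ ?_ ?_
    · rw [Finset.disjoint_biUnion_right]
      intro j hj
      exact hS (by rintro rfl; exact hk hj)
    · exact Finset.measurableSet_biInter _ fun i hi => hf i (hsets i (Finset.mem_insert_of_mem hi))
    · intro x y hxy
      simp only [Set.mem_preimage, df k hxy]
    · intro x y hxy
      simp only [Set.mem_iInter, Set.mem_preimage, eq_iff_iff]
      refine forall₂_congr fun j hj => ?_
      rw [df j fun i hi => hxy i (Finset.mem_coe.2 (Finset.mem_biUnion.2 ⟨j, hj, hi⟩))]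

end Independence

/-! ### Concentration for counts of independent or local events -/

section Counting

open Classical in
lemma card_filter_eq_sum_indicator {Ω κ : Type*} (s : Finset κ) (A : κ → Set Ω) (ω : Ω) :
    (((s.filter fun k => ω ∈ A k).card : ℕ) : ℝ) = ∑ k ∈ s, (A k).indicator (fun _ => (1 : ℝ)) ω := by
  rw [Finset.card_filter]
  push_cast
  exact Finset.sum_congr rfl fun k _ => by simp [Set.indicator_apply]

variable {Ω : Type*} [MeasurableSpace Ω] {P : Measure Ω} [IsProbabilityMeasure P]

open Classical in
lemma integrable_card_filter {κ : Type*} (s : Finset κ) {A : κ → Set Ω}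
    (hA : ∀ k, MeasurableSet (A k)) :
    Integrable (fun ω => (((s.filter fun k => ω ∈ A k).card : ℕ) : ℝ)) P := by
  simp_rw [card_filter_eq_sum_indicator]
  exact integrable_finsetSum _ fun k _ => (integrable_const 1).indicator (hA k)

open Classical in
lemma integral_card_filter {κ : Type*} (s : Finset κ) {A : κ → Set Ω}
    (hA : ∀ k, MeasurableSet (A k)) :
    ∫ ω, (((s.filter fun k => ω ∈ A k).card : ℕ) : ℝ) ∂P = ∑ k ∈ s, P.real (A k) := by
  simp_rw [card_filter_eq_sum_indicator]
  rw [integral_finsetSum _ fun k _ => (integrable_const 1).indicator (hA k)]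
  exact Finset.sum_congr rfl fun k _ => by
    rw [integral_indicator_const _ (hA k)]; simp

open Classical in
/-- Hoeffding's inequality for the number of occurrences among independent events. -/
lemma measureReal_card_ge_le {κ : Type*} (s : Finset κ) {A : κ → Set Ω}
    (hA : ∀ k, MeasurableSet (A k))
    (hind : iIndepFun (fun k => (A k).indicator (fun _ => (1 : ℝ))) P) {q δ : ℝ} (hδ : 0 ≤ δ)
    (hq : ∀ k ∈ s, P.real (A k) ≤ q) :
    P.real {ω | (s.card : ℝ) * (q + δ) ≤ ((s.filter fun k => ω ∈ A k).card : ℝ)} ≤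
      Real.exp (-2 * δ ^ 2 * s.card) := by
  have hm : ∀ k, Measurable ((A k).indicator (fun _ => (1 : ℝ))) := fun k =>
    measurable_const.indicator (hA k)
  have hint : ∀ k, ∫ ω, (A k).indicator (fun _ => (1 : ℝ)) ω ∂P = P.real (A k) := fun k => by
    rw [integral_indicator_const _ (hA k)]; simp
  have hsub : ∀ k ∈ s, HasSubgaussianMGF
      (fun ω => (A k).indicator (fun _ => (1 : ℝ)) ω - P.real (A k)) ((1 / 2) ^ 2) P := by
    intro k _
    have := hasSubgaussianMGF_of_mem_Icc (μ := P) (a := 0) (b := 1) (hm k).aemeasurable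
      (ae_of_all _ fun ω => by
        by_cases h : ω ∈ A k <;> simp [h])
    rw [hint k] at this
    simpa using this
  have hind' : iIndepFun (fun k ω => (A k).indicator (fun _ => (1 : ℝ)) ω - P.real (A k)) P :=
    hind.comp (fun k x => x - P.real (A k)) fun k => measurable_id.sub_const _
  have h := HasSubgaussianMGF.measure_sum_ge_le_of_iIndepFun hind' hsub
    (ε := s.card * δ) (by positivity)
  refine (measureReal_mono ?_).trans (h.trans (le_of_eq ?_))
  · intro ω hω
    simp only [Set.mem_ofPred_eq] at hω ⊢
    rw [card_filter_eq_sum_indicator] at hω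
    rw [Finset.sum_sub_distrib]
    have : ∑ k ∈ s, P.real (A k) ≤ s.card * q := by
      simpa using Finset.sum_le_card_nsmul s _ _ hq
    nlinarith
  · congr 1
    rcases Nat.eq_zero_or_pos s.card with h0 | h0
    · simp [h0]
    · have : (0 : ℝ) < s.card := by exact_mod_cast h0
      simp
      field_simp

open Classical in
/-- Hoeffding's inequality for the number of occurrences of local events of a product measure. -/
lemma infinitePi_card_ge_le {X : Type*} [MeasurableSpace X] (ν : Measure X)
    [IsProbabilityMeasure ν] (r : ℕ) {A : ℤ → Set (ℤ → X)} (hA : ∀ x, MeasurableSet (A x))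
    (dA : ∀ x, DependsOn (fun ω => ω ∈ A x) (Finset.Icc (x - r) (x + r) : Set ℤ))
    {q δ : ℝ} (hδ : 0 ≤ δ) (c : ℤ) (N : ℕ)
    (hq : ∀ x ∈ Finset.Ico c (c + N * (2 * r + 1)),
      (Measure.infinitePi fun _ : ℤ => ν).real (A x) ≤ q) :
    (Measure.infinitePi fun _ : ℤ => ν).real
      {ω | (N * (2 * r + 1) : ℝ) * (q + δ) ≤
        (((Finset.Ico c (c + N * (2 * r + 1))).filter fun x => ω ∈ A x).card : ℝ)} ≤
      (2 * r + 1) * Real.exp (-2 * δ ^ 2 * N) := by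
  -- Distinct sites congruent modulo `m` have disjoint windows of radius `r`, and each residue class
  -- meets the interval in exactly `N` sites. Hoeffding applies within a class; if the total is too
  -- large, so is the count in some class, and a union bound over the `m` classes concludes.
  set m : ℕ := 2 * r + 1 with hm
  set I : Finset ℤ := Finset.Ico c (c + N * (2 * r + 1)) with hI
  set P := Measure.infinitePi fun _ : ℤ => ν
  have hcard : ∀ j : ℕ, (I.filter fun x => x ≡ j [ZMOD m]).card = N := by
    intro j
    have := Int.Ico_filter_modEq_card c (c + N * (2 * r + 1)) (r := (m : ℤ))
      (by simp [hm]) j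
    have e : (((c + N * (2 * r + 1) : ℤ) - j : ℚ) / (m : ℤ)) = ((c : ℤ) - (j : ℤ) : ℚ) / (m : ℤ) + (N : ℤ) := by
      have : ((m : ℤ) : ℚ) ≠ 0 := by simp [hm]; positivity
      field_simp
      simp [hm]; ring
    have h3 : (((I.filter fun x => x ≡ j [ZMOD m]).card : ℕ) : ℤ) = N := by
      rw [hI, this]
      push_cast at e ⊢
      rw [e]
      have := Int.ceil_add_natCast ((c - j : ℚ) / m) N
      rw [this]; simp
    exact_mod_cast h3
  have hclass : ∀ j : ℕ, P.real {ω | (N : ℝ) * (q + δ) ≤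
      (((I.filter fun x => x ≡ j [ZMOD m]).filter fun x => ω ∈ A x).card : ℝ)} ≤
      Real.exp (-2 * δ ^ 2 * N) := by
    intro j
    let T := {x : ℤ // x ≡ j [ZMOD m]}
    let s : Finset T := I.subtype fun x => x ≡ j [ZMOD m]
    have hs : s.card = N := by rw [Finset.card_subtype, hcard]
    have hind : iIndepFun (fun k : T => (A k).indicator (fun _ => (1 : ℝ))) P := by
      refine iIndepFun_of_dependsOn (fun _ => ν)
        (S := fun k : T => Finset.Icc ((k : ℤ) - r) (k + r)) ?_
        (fun k => measurable_const.indicator (hA k)) ?_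
      · intro k l hkl
        rw [Finset.disjoint_left]
        intro x hx hy
        rw [Finset.mem_Icc] at hx hy
        apply hkl
        have h := k.2.trans l.2.symm
        have h1 := (Int.modEq_iff_dvd.1 h)
        have h2 := Int.eq_zero_of_abs_lt_dvd h1 (by rw [abs_lt]; constructor <;> (simp [hm]; omega))
        exact Subtype.ext (by omega)
      · intro k x y hxy
        have := dA k hxy
        simp only [Set.indicator_apply, this]
    have h := measureReal_card_ge_le s (A := fun k : T => A k) (fun k => hA k) hind hδ (q := q)
      (fun k hk => hq k (Finset.mem_subtype.1 hk))
    rw [hs] at h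
    refine le_trans (le_of_eq ?_) h
    congr 1
    ext ω
    simp only [Set.mem_ofPred_eq]
    have : ((I.filter fun x => x ≡ j [ZMOD m]).filter fun x => ω ∈ A x).card =
        (s.filter fun k : T => ω ∈ A k).card := by
      rw [← Finset.card_map (Function.Embedding.subtype fun x : ℤ => x ≡ j [ZMOD m])]
      congr 1
      ext x
      simp only [Finset.mem_filter, Finset.mem_map, Finset.mem_subtype, s,
        Function.Embedding.subtype_apply]
      constructor
      · rintro ⟨⟨h1, h2⟩, h3⟩
        exact ⟨⟨x, h2⟩, ⟨h1, h3⟩, rfl⟩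
      · rintro ⟨k, ⟨h1, h3⟩, rfl⟩
        exact ⟨⟨h1, k.2⟩, h3⟩
    rw [this]
  have hsub : {ω | (N * (2 * r + 1) : ℝ) * (q + δ) ≤ ((I.filter fun x => ω ∈ A x).card : ℝ)} ⊆
      ⋃ j ∈ Finset.range m, {ω | (N : ℝ) * (q + δ) ≤
      (((I.filter fun x => x ≡ j [ZMOD m]).filter fun x => ω ∈ A x).card : ℝ)} := by
    intro ω hω
    by_contra hcon
    simp only [Set.mem_iUnion, Set.mem_ofPred_eq, not_exists, not_le] at hcon hω
    have h1 : (I.filter fun x => ω ∈ A x).card = ∑ j ∈ Finset.range m,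
        ((I.filter fun x => ω ∈ A x).filter fun x : ℤ => (x % (m : ℤ)).toNat = j).card := by
      refine Finset.card_eq_sum_card_fiberwise fun x _ => ?_
      have := Int.emod_lt_of_pos x (b := m) (by simp [hm])
      simp only [Finset.coe_range, Set.mem_Iio]
      omega
    have h2 : ∀ j ∈ Finset.range m,
        (I.filter fun x => ω ∈ A x).filter (fun x : ℤ => (x % (m : ℤ)).toNat = j) =
        (I.filter fun x => x ≡ j [ZMOD m]).filter fun x => ω ∈ A x := by
      intro j hj
      ext x
      simp only [Finset.mem_filter, Finset.mem_range] at hj ⊢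
      have h0 := Int.emod_nonneg x (b := m) (by simp [hm]; omega)
      have h3 : (x % (m : ℤ)).toNat = j ↔ x ≡ j [ZMOD m] := by
        rw [Int.ModEq, Int.emod_eq_of_lt (a := (j : ℤ)) (by omega) (by omega)]
        omega
      rw [h3]; tauto
    rw [Finset.sum_congr rfl fun j hj => by rw [h2 j hj]] at h1
    rw [h1] at hω
    push_cast at hω
    have h4 := Finset.sum_lt_sum_of_nonempty (s := Finset.range m) (by simp [hm])
      (fun j hj => hcon j hj)
    simp only [Finset.sum_const, Finset.card_range, nsmul_eq_mul] at h4
    have : (m : ℝ) = 2 * r + 1 := by simp [hm]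
    rw [this] at h4
    linarith
  calc _ ≤ P.real _ := measureReal_mono hsub (measure_ne_top _ _)
    _ ≤ ∑ j ∈ Finset.range m, P.real _ := measureReal_biUnion_finset_le _ _
    _ ≤ ∑ j ∈ Finset.range m, Real.exp (-2 * δ ^ 2 * N) := Finset.sum_le_sum fun j _ => hclass j
    _ = _ := by simp [hm]

end Counting

/-! ### Exit estimates for the simple random walk -/

/-- The law of the steps of a simple symmetric random walk. -/
abbrev stepLaw : Measure (ℕ → ℤˣ) := Measure.infinitePi fun _ : ℕ => signLaw half

/-- The displacement after `n` steps. -/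
def displacement (s : ℕ → ℤˣ) (n : ℕ) : ℤ := ∑ i ∈ Finset.range n, ((s i : ℤˣ) : ℤ)

/-- The displacement, stopped upon exit from the open interval `(-a, b)`. -/
def stoppedDisplacement (a b : ℤ) (s : ℕ → ℤˣ) : ℕ → ℤ
  | 0 => 0
  | n + 1 => stoppedDisplacement a b s n +
      if stoppedDisplacement a b s n ∈ Set.Ioo (-a) b then ((s n : ℤˣ) : ℤ) else 0

instance : MeasurableSingletonClass ℤˣ where
  measurableSet_singleton u := ⟨{(u : ℤ)}, measurableSet_singleton _, by ext v; simp [Units.ext_iff]⟩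

lemma units_int_cases (u : ℤˣ) : (u : ℤ) = 1 ∨ (u : ℤ) = -1 := by
  rcases Int.units_eq_one_or u with h | h <;> simp [h]

section Pathwise

variable {a b : ℤ} (s : ℕ → ℤˣ)

/-- Here `k` is the smaller of `n` and the exit time. Unit steps cannot jump over an endpoint, so
the walk is still in the closed interval at its exit. -/
lemma stoppedDisplacement_spec (ha : 0 < a) (hb : 0 < b) (n : ℕ) :
    ∃ k ≤ n, stoppedDisplacement a b s n = displacement s k ∧
      (∀ j ≤ k, displacement s j ∈ Set.Icc (-a) b) ∧
      (stoppedDisplacement a b s n ∈ Set.Ioo (-a) b →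
        k = n ∧ ∀ j ≤ n, displacement s j ∈ Set.Ioo (-a) b) := by
  induction n with
  | zero =>
    refine ⟨0, le_rfl, by simp [stoppedDisplacement, displacement], ?_, fun _ => ⟨rfl, ?_⟩⟩ <;>
    · intro j hj
      obtain rfl : j = 0 := by omega
      simp [displacement]; omega
  | succ n ih =>
    obtain ⟨k, hk, hkd, hkI, hko⟩ := ih
    by_cases h : stoppedDisplacement a b s n ∈ Set.Ioo (-a) b
    · obtain ⟨rfl, hj⟩ := hko h
      have e : stoppedDisplacement a b s (k + 1) = displacement s (k + 1) := by
        rw [stoppedDisplacement, if_pos h, hkd, displacement, displacement, Finset.sum_range_succ]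
      have hI : displacement s (k + 1) ∈ Set.Icc (-a) b := by
        rw [← e, stoppedDisplacement, if_pos h]
        have := units_int_cases (s k)
        simp only [Set.mem_Ioo, Set.mem_Icc] at h ⊢
        omega
      refine ⟨k + 1, le_rfl, e, ?_, fun h' => ⟨rfl, ?_⟩⟩
      · intro j hj'
        rcases Nat.lt_or_ge j (k + 1) with h1 | h1
        · exact hkI j (by omega)
        · obtain rfl : j = k + 1 := by omega
          exact hI
      · intro j hj'
        rcases Nat.lt_or_ge j (k + 1) with h1 | h1
        · exact hj j (by omega)
        · obtain rfl : j = k + 1 := by omega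
          rwa [← e]
    · have e : stoppedDisplacement a b s (n + 1) = stoppedDisplacement a b s n := by
        rw [stoppedDisplacement, if_neg h, add_zero]
      exact ⟨k, by omega, by rw [e, hkd], hkI, fun h' => absurd (e ▸ h') h⟩

lemma stoppedDisplacement_mem (ha : 0 < a) (hb : 0 < b) (n : ℕ) :
    stoppedDisplacement a b s n ∈ Set.Icc (-a) b := by
  obtain ⟨k, -, hk, hI, -⟩ := stoppedDisplacement_spec s ha hb n
  exact hk ▸ hI k le_rfl

end Pathwise

lemma dependsOn_stoppedDisplacement (a b : ℤ) (n : ℕ) :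
    DependsOn (fun s => stoppedDisplacement a b s n) (Finset.range n : Set ℕ) := by
  induction n with
  | zero => intro s t _; rfl
  | succ n ih =>
    intro s t h
    have h1 := ih (x := s) (y := t) fun i hi => h i (by simp at hi ⊢; omega)
    have h2 := h n (by simp)
    simp only [stoppedDisplacement] at h1 ⊢
    rw [h1, h2]

lemma measurable_coe_unit (n : ℕ) : Measurable fun s : ℕ → ℤˣ => ((s n : ℤˣ) : ℤ) :=
  (measurable_of_countable fun u : ℤˣ => (u : ℤ)).comp (measurable_pi_apply n)

lemma measurable_displacement (n : ℕ) : Measurable fun s => displacement s n :=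
  Finset.measurable_fun_sum _ fun i _ => measurable_coe_unit i

lemma measurable_stoppedDisplacement (a b : ℤ) (n : ℕ) :
    Measurable fun s => stoppedDisplacement a b s n := by
  induction n with
  | zero => exact measurable_const
  | succ n ih =>
    exact ih.add (Measurable.ite (ih (Set.to_countable _).measurableSet) (measurable_coe_unit n)
      measurable_const)

lemma integral_signLaw_half : ∫ u, ((u : ℤ) : ℝ) ∂(signLaw half) = 0 := by
  rw [signLaw, integral_add_measure, integral_smul_measure, integral_smul_measure,
    integral_dirac, integral_dirac]
  · simp [half]; norm_num
  · exact (integrable_dirac (by simp)).smul_measure ENNReal.ofReal_ne_top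
  · exact (integrable_dirac (by simp)).smul_measure ENNReal.ofReal_ne_top

/-- The martingale property: the stopped walk at time `n` uses only earlier steps, and step `n` is
centred and independent of them. -/
lemma integral_comp_stopped_mul_step (a b : ℤ) (n : ℕ) (f : ℤ → ℝ) :
    ∫ s, f (stoppedDisplacement a b s n) * (((s n : ℤˣ) : ℤ) : ℝ) ∂stepLaw = 0 := by
  have hind : IndepFun (fun s => stoppedDisplacement a b s n) (fun s : ℕ → ℤˣ => s n) stepLaw := by
    refine indepFun_of_dependsOn (S := Finset.range n) (T := {n}) _ (by simp)
      (measurable_stoppedDisplacement a b n) (measurable_pi_apply n)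
      (dependsOn_stoppedDisplacement a b n) ?_
    intro s t h
    exact h n (by simp)
  have h := (hind.comp (φ := f) (ψ := fun u : ℤˣ => ((u : ℤ) : ℝ)) (measurable_of_countable _)
    (measurable_of_countable _)).integral_fun_mul_eq_mul_integral
    ((measurable_of_countable f).comp (measurable_stoppedDisplacement a b n)).aestronglyMeasurable
    ((measurable_of_countable _).comp (measurable_pi_apply n)).aestronglyMeasurable
  simp only [Function.comp_apply] at h
  rw [h]
  have : ∫ s : ℕ → ℤˣ, (((s n : ℤˣ) : ℤ) : ℝ) ∂stepLaw = 0 := by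
    rw [← integral_signLaw_half, ← Measure.infinitePi_map_eval (fun _ : ℕ => signLaw half) n,
      integral_map (measurable_pi_apply n).aemeasurable
        (measurable_of_countable _).aestronglyMeasurable]
  rw [this, mul_zero]

section Moments

variable {a b : ℤ}

lemma integrable_comp_stopped (ha : 0 < a) (hb : 0 < b) (n : ℕ) (f : ℤ × ℤˣ → ℝ) :
    Integrable (fun s => f (stoppedDisplacement a b s n, s n)) stepLaw := by
  obtain ⟨z, hz⟩ := Set.exists_upper_bound_image (Set.Icc (-a) b ×ˢ (Set.univ : Set ℤˣ))
    (fun z => |f z|) ((Set.finite_Icc _ _).prod Set.finite_univ)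
  refine Integrable.of_bound ((measurable_of_countable f).comp
    ((measurable_stoppedDisplacement a b n).prodMk (measurable_pi_apply n))).aestronglyMeasurable
    |f z| (ae_of_all _ fun s => ?_)
  exact hz _ ⟨stoppedDisplacement_mem s ha hb n, trivial⟩

lemma integral_stopped (ha : 0 < a) (hb : 0 < b) (n : ℕ) :
    ∫ s, (stoppedDisplacement a b s n : ℝ) ∂stepLaw = 0 := by
  induction n with
  | zero => simp [stoppedDisplacement]
  | succ n ih =>
    have e : ∀ s, (stoppedDisplacement a b s (n + 1) : ℝ) = stoppedDisplacement a b s n +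
        (Set.Ioo (-a) b).indicator (fun _ => (1 : ℝ)) (stoppedDisplacement a b s n) *
          ((s n : ℤˣ) : ℤ) := by
      intro s
      rw [stoppedDisplacement, Set.indicator_apply]
      split_ifs <;> simp
    simp_rw [e]
    rw [integral_add (integrable_comp_stopped ha hb n fun z => z.1)
      (integrable_comp_stopped ha hb n fun z =>
        (Set.Ioo (-a) b).indicator (fun _ => (1 : ℝ)) z.1 * (z.2 : ℤ)),
      ih, integral_comp_stopped_mul_step, add_zero]

lemma measurableSet_stopped_mem (a b : ℤ) (n : ℕ) (A : Set ℤ) :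
    MeasurableSet {s | stoppedDisplacement a b s n ∈ A} :=
  measurable_stoppedDisplacement a b n (Set.to_countable A).measurableSet

/-- Before exit each increment has square one, and the cross term vanishes by the martingale
property. -/
lemma integral_stopped_sq_succ (ha : 0 < a) (hb : 0 < b) (n : ℕ) :
    ∫ s, (stoppedDisplacement a b s (n + 1) : ℝ) ^ 2 ∂stepLaw =
      ∫ s, (stoppedDisplacement a b s n : ℝ) ^ 2 ∂stepLaw +
        stepLaw.real {s | stoppedDisplacement a b s n ∈ Set.Ioo (-a) b} := by
  have e : ∀ s, (stoppedDisplacement a b s (n + 1) : ℝ) ^ 2 =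
      ((stoppedDisplacement a b s n : ℝ) ^ 2 +
      (Set.Ioo (-a) b).indicator (fun _ => (1 : ℝ)) (stoppedDisplacement a b s n)) +
      (2 * (stoppedDisplacement a b s n : ℝ) *
        (Set.Ioo (-a) b).indicator (fun _ => (1 : ℝ)) (stoppedDisplacement a b s n)) *
        ((s n : ℤˣ) : ℤ) := by
    intro s
    rw [stoppedDisplacement, Set.indicator_apply]
    split_ifs
    · rcases units_int_cases (s n) with h | h <;> rw [h] <;> push_cast <;> ring
    · simp
  have e2 : ∫ s, (Set.Ioo (-a) b).indicator (fun _ => (1 : ℝ)) (stoppedDisplacement a b s n)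
      ∂stepLaw = stepLaw.real {s | stoppedDisplacement a b s n ∈ Set.Ioo (-a) b} := by
    rw [← mul_one (stepLaw.real _), ← smul_eq_mul,
      ← integral_indicator_const (1 : ℝ) (measurableSet_stopped_mem a b n (Set.Ioo (-a) b))]
    rfl
  simp_rw [e]
  rw [integral_add (integrable_comp_stopped ha hb n fun z =>
      (z.1 : ℝ) ^ 2 + (Set.Ioo (-a) b).indicator (fun _ => (1 : ℝ)) z.1)
    (integrable_comp_stopped ha hb n fun z =>
      (2 * (z.1 : ℝ) * (Set.Ioo (-a) b).indicator (fun _ => (1 : ℝ)) z.1) * (z.2 : ℤ)),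
    integral_add (integrable_comp_stopped ha hb n fun z => (z.1 : ℝ) ^ 2)
      (integrable_comp_stopped ha hb n fun z =>
        (Set.Ioo (-a) b).indicator (fun _ => (1 : ℝ)) z.1),
    integral_comp_stopped_mul_step a b n fun z =>
      2 * (z : ℝ) * (Set.Ioo (-a) b).indicator (fun _ => (1 : ℝ)) z, e2, add_zero]

lemma integral_stopped_sq_le (ha : 0 < a) (hb : 0 < b) (n : ℕ) :
    ∫ s, (stoppedDisplacement a b s n : ℝ) ^ 2 ∂stepLaw ≤ n := by
  induction n with
  | zero => simp [stoppedDisplacement]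
  | succ n ih =>
    rw [integral_stopped_sq_succ ha hb]
    push_cast
    exact add_le_add ih measureReal_le_one

/-- The second moment is the sum of the probabilities of not having exited at times `0, …, n - 1`,
and these decrease in time. -/
lemma mul_measureReal_stopped_mem_Ioo_le (ha : 0 < a) (hb : 0 < b) (n : ℕ) :
    n * stepLaw.real {s | stoppedDisplacement a b s n ∈ Set.Ioo (-a) b} ≤
      ∫ s, (stoppedDisplacement a b s n : ℝ) ^ 2 ∂stepLaw := by
  induction n with
  | zero => simp [stoppedDisplacement]
  | succ n ih =>
    rw [integral_stopped_sq_succ ha hb]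
    have : stepLaw.real {s | stoppedDisplacement a b s (n + 1) ∈ Set.Ioo (-a) b} ≤
        stepLaw.real {s | stoppedDisplacement a b s n ∈ Set.Ioo (-a) b} := by
      refine measureReal_mono fun s hs => ?_
      by_contra h
      simp only [Set.mem_ofPred_eq] at h hs
      rw [stoppedDisplacement, if_neg h, add_zero] at hs
      exact h hs
    push_cast
    nlinarith

/-- A simple random walk hits `-a` within `n` steps and before exceeding `b`, with probability at
least `b / (a + b) - b ^ 2 / n`. -/
lemma le_measureReal_hit (ha : 0 < a) (hab : a ≤ b) {n : ℕ} (hn : 0 < n) :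
    (b : ℝ) / (a + b) - b ^ 2 / n ≤ stepLaw.real {s | ∃ k ≤ n, displacement s k = -a ∧
      ∀ j ≤ k, displacement s j ∈ Set.Icc (-a) b} := by
  have hb : 0 < b := ha.trans_le hab
  have ha' : (0 : ℝ) < a := by exact_mod_cast ha
  have hab' : (a : ℝ) ≤ b := by exact_mod_cast hab
  have hn' : (0 : ℝ) < n := by exact_mod_cast hn
  have hmem := fun s => stoppedDisplacement_mem s ha hb n
  set I : Set (ℕ → ℤˣ) := {s | stoppedDisplacement a b s n ∈ Set.Ioo (-a) b}
  set U : Set (ℕ → ℤˣ) := {s | stoppedDisplacement a b s n ∈ Set.Iio b}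
  set G : Set (ℕ → ℤˣ) := {s | ∃ k ≤ n, displacement s k = -a ∧
      ∀ j ≤ k, displacement s j ∈ Set.Icc (-a) b}
  have h1 : stepLaw.real I ≤ b ^ 2 / n := by
    rw [le_div_iff₀ hn', mul_comm]
    refine (mul_measureReal_stopped_mem_Ioo_le ha hb n).trans ?_
    have : ∫ s, (stoppedDisplacement a b s n : ℝ) ^ 2 ∂stepLaw ≤ ∫ _s, (b : ℝ) ^ 2 ∂stepLaw := by
      refine integral_mono (integrable_comp_stopped ha hb n fun z => (z.1 : ℝ) ^ 2)
        (integrable_const _) fun s => ?_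
      have h1 : (-a : ℝ) ≤ stoppedDisplacement a b s n := by exact_mod_cast (hmem s).1
      have h2 : (stoppedDisplacement a b s n : ℝ) ≤ b := by exact_mod_cast (hmem s).2
      have : -(b : ℝ) ≤ stoppedDisplacement a b s n := by linarith
      simp only
      nlinarith
    simpa using this
  -- Optional stopping: the stopped walk has mean zero, is at least `-a` on `U` and at least `b` off
  -- `U`.
  have h2 : (b : ℝ) / (a + b) ≤ stepLaw.real U := by
    rw [div_le_iff₀ (by linarith)]
    have : ∫ s, ((b : ℝ) - (a + b) * U.indicator (fun _ => (1 : ℝ)) s) ∂stepLaw ≤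
        ∫ s, (stoppedDisplacement a b s n : ℝ) ∂stepLaw := by
      refine integral_mono ((integrable_const _).sub (((integrable_const _).indicator
        (measurableSet_stopped_mem a b n _)).const_mul _))
        (integrable_comp_stopped ha hb n fun z => (z.1 : ℝ)) fun s => ?_
      have h1 : (-a : ℝ) ≤ stoppedDisplacement a b s n := by exact_mod_cast (hmem s).1
      by_cases hs : s ∈ U
      · simp [hs]; linarith
      · have : (b : ℝ) ≤ stoppedDisplacement a b s n := by
          exact_mod_cast not_lt.1 (show ¬ stoppedDisplacement a b s n < b from hs)
        simpa [hs] using this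
    rw [integral_stopped ha hb, integral_sub (integrable_const _) (((integrable_const _).indicator
        (measurableSet_stopped_mem a b n _)).const_mul _), integral_const_mul,
        integral_indicator_const _ (measurableSet_stopped_mem a b n _)] at this
    simp only [integral_const, probReal_univ, smul_eq_mul, one_mul, mul_one] at this
    linarith
  have h3 : U ⊆ I ∪ G := by
    intro s hs
    by_cases h : s ∈ I
    · exact Or.inl h
    · right
      obtain ⟨k, hk, hkd, hkI, -⟩ := stoppedDisplacement_spec s ha hb n
      refine ⟨k, hk, ?_, hkI⟩
      have := (hmem s).1
      have h' : ¬ (-a < stoppedDisplacement a b s n ∧ stoppedDisplacement a b s n < b) := h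
      have hs' : stoppedDisplacement a b s n < b := hs
      rw [← hkd]; omega
  have h4 := (measureReal_mono h3 (measure_ne_top stepLaw _)).trans (measureReal_union_le _ _)
  linarith

/-- Kolmogorov's maximal inequality for the simple random walk. -/
lemma measureReal_exists_abs_displacement_eq_le {x : ℤ} (hx : 0 < x) (n : ℕ) :
    stepLaw.real {s | ∃ k ≤ n, |displacement s k| = x} ≤ n / x ^ 2 := by
  have hx' : (0 : ℝ) < x := by exact_mod_cast hx
  set I : Set (ℕ → ℤˣ) := {s | stoppedDisplacement x x s n ∈ Set.Ioo (-x) x}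
  have hI : MeasurableSet I := measurableSet_stopped_mem x x n _
  have h1 : {s | ∃ k ≤ n, |displacement s k| = x} ⊆ Iᶜ := by
    rintro s ⟨k, hk, hkx⟩ hs
    obtain ⟨l, -, -, -, hl⟩ := stoppedDisplacement_spec s hx hx n
    have := abs_lt.2 ((hl hs).2 k hk)
    omega
  refine (measureReal_mono h1 (measure_ne_top stepLaw _)).trans ?_
  rw [le_div_iff₀ (by positivity)]
  refine le_trans ?_ (integral_stopped_sq_le hx hx n)
  -- Off `I` the stopped walk sits at `x` or `-x`; this is Chebyshev's inequality for the stopped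
  -- walk.
  have : ∫ s, (x : ℝ) ^ 2 * Iᶜ.indicator (fun _ => (1 : ℝ)) s ∂stepLaw ≤
      ∫ s, (stoppedDisplacement x x s n : ℝ) ^ 2 ∂stepLaw := by
    refine integral_mono (((integrable_const _).indicator hI.compl).const_mul _)
      (integrable_comp_stopped hx hx n fun z => (z.1 : ℝ) ^ 2) fun s => ?_
    by_cases hs : s ∈ I
    · simp [hs]; positivity
    · have hm := stoppedDisplacement_mem s hx hx n
      have h' : ¬ (-x < stoppedDisplacement x x s n ∧ stoppedDisplacement x x s n < x) := hs
      have : stoppedDisplacement x x s n = x ∨ stoppedDisplacement x x s n = -x := by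
        have := hm.1; have := hm.2; omega
      rcases this with h | h <;> simp [hs, h]
  rw [integral_const_mul, integral_indicator_const _ hI.compl] at this
  simp at this ⊢
  linarith

end Moments

/-! ### Deterministic properties of the parking process -/

/-- No two marks for the same time coincide. -/
def NoTies (ω : Config) : Prop := ∀ (n : ℕ) (u v : ℤ), u ≠ v → mark ω u n ≠ mark ω v n

variable {ω : Config}

lemma walk_eq (ω : Config) (v : ℤ) (n : ℕ) : walk ω v n = v + displacement (ω v).2.1 n := rfl

lemma abs_displacement_le (s : ℕ → ℤˣ) (n : ℕ) : |displacement s n| ≤ n := by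
  unfold displacement
  refine (Finset.abs_sum_le_sum_abs _ _).trans (le_of_eq ?_)
  have : ∀ i, |((s i : ℤˣ) : ℤ)| = 1 := fun i => by
    rcases units_int_cases (s i) with h | h <;> simp [h]
  simp [this]

lemma walk_mem_Icc (ω : Config) (v : ℤ) (n : ℕ) : walk ω v n ∈ Set.Icc (v - n) (v + n) := by
  have := abs_le.1 (abs_displacement_le (ω v).2.1 n)
  rw [walk_eq, Set.mem_Icc]
  omega

lemma unparked_antitone (ω : Config) : Antitone fun n => (state ω n).unparked :=
  antitone_nat_of_succ_le fun _ _ h => h.1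

lemma vacant_antitone (ω : Config) : Antitone fun n => (state ω n).vacant :=
  antitone_nat_of_succ_le fun _ _ h => h.1

lemma isCar_of_mem_unparked {v : ℤ} {n : ℕ} (h : v ∈ (state ω n).unparked) : IsCar ω v :=
  unparked_antitone ω (Nat.zero_le n) h

lemma isSpot_of_mem_vacant {x : ℤ} {n : ℕ} (h : x ∈ (state ω n).vacant) : IsSpot ω x :=
  vacant_antitone ω (Nat.zero_le n) h

lemma notMem_vacant_of_parksFrom {n m : ℕ} {v : ℤ} (h : ParksFrom ω (state ω n) (n + 1) v)
    (hm : n + 1 ≤ m) : walk ω v (n + 1) ∉ (state ω m).vacant := fun hx =>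
  (vacant_antitone ω hm hx).2 ⟨v, h, rfl⟩

/-- Only finitely many cars can reach a given site by a given time, so one of maximal mark exists;
without ties it beats all others strictly. -/
lemma filledAt_of_visit (hω : NoTies ω) {n : ℕ} {v : ℤ} (hv : v ∈ (state ω n).unparked)
    (hx : walk ω v (n + 1) ∈ (state ω n).vacant) : FilledAt ω (walk ω v (n + 1)) n := by
  set x := walk ω v (n + 1)
  set C : Set ℤ := {u | u ∈ (state ω n).unparked ∧ walk ω u (n + 1) = x}
  have hC : C.Finite := by
    refine (Set.finite_Icc (x - (n + 1 : ℕ)) (x + (n + 1 : ℕ))).subset fun u hu => ?_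
    have := walk_mem_Icc ω u (n + 1)
    rw [hu.2] at this
    simp only [Set.mem_Icc] at this ⊢
    omega
  obtain ⟨w, hw, hmax⟩ := Set.exists_max_image C (fun u => mark ω u (n + 1)) hC ⟨v, hv, rfl⟩
  refine ⟨w, ⟨hw.1, hw.2 ▸ hx, fun u hu huw huw' => ?_⟩, hw.2⟩
  exact lt_of_le_of_ne (hmax u ⟨hu, huw'.trans hw.2⟩) (hω _ _ _ huw)

lemma notMem_vacant_of_visit (hω : NoTies ω) {n m : ℕ} {v : ℤ} (hv : v ∈ (state ω n).unparked)
    (hm : n + 1 ≤ m) : walk ω v (n + 1) ∉ (state ω m).vacant := by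
  intro hx
  obtain ⟨w, hw, hwx⟩ := filledAt_of_visit hω hv (vacant_antitone ω (by omega) hx)
  exact notMem_vacant_of_parksFrom hw hm (hwx ▸ hx)

/-- A spot serves one car: after it is filled it is never vacant again, and at one time the strict
comparison of marks excludes two winners. -/
lemma parksFrom_inj {i j : ℕ} {u v : ℤ} (hu : ParksFrom ω (state ω i) (i + 1) u)
    (hv : ParksFrom ω (state ω j) (j + 1) v) (h : walk ω u (i + 1) = walk ω v (j + 1)) :
    u = v := by
  rcases lt_trichotomy i j with hij | rfl | hij
  · exact absurd (h ▸ hv.2.1) (notMem_vacant_of_parksFrom hu hij)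
  · by_contra huv
    exact lt_asymm (hu.2.2 v hv.1 (Ne.symm huv) h.symm) (hv.2.2 u hu.1 huv h)
  · exact absurd (h ▸ hu.2.1) (notMem_vacant_of_parksFrom hv hij)

lemma exists_parksFrom {m n : ℕ} {v : ℤ} (hm : v ∈ (state ω m).unparked)
    (hn : v ∉ (state ω n).unparked) :
    ∃ j, m ≤ j ∧ j < n ∧ ParksFrom ω (state ω j) (j + 1) v := by
  induction n with
  | zero => exact absurd (isCar_of_mem_unparked hm) hn
  | succ n ih =>
    by_cases h : v ∈ (state ω n).unparked
    · have hp : ParksFrom ω (state ω n) (n + 1) v := by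
        by_contra hp
        exact hn ⟨h, hp⟩
      refine ⟨n, ?_, by omega, hp⟩
      by_contra hmn
      exact hn (unparked_antitone ω (by omega : n + 1 ≤ m) hm)
    · obtain ⟨j, h1, h2, h3⟩ := ih h
      exact ⟨j, h1, by omega, h3⟩

lemma isCar_or_isSpot (ω : Config) (v : ℤ) : IsCar ω v ∨ IsSpot ω v :=
  Int.units_eq_one_or (ω v).1

lemma not_isCar_and_isSpot (ω : Config) (v : ℤ) : ¬ (IsCar ω v ∧ IsSpot ω v) := by
  rintro ⟨h1, h2⟩
  have : (1 : ℤˣ) = -1 := h1.symm.trans h2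
  exact absurd this (by decide)

open Classical in
/-- The cars from an interval that have parked have done so in distinct spots near the interval. -/
lemma card_isCar_le (ω : Config) (c : ℤ) (M n : ℕ) :
    ((Finset.Ico c (c + M)).filter fun v => IsCar ω v).card ≤
      ((Finset.Ico c (c + M)).filter fun v => v ∈ (state ω n).unparked).card +
      ((Finset.Ico c (c + M)).filter fun v => IsSpot ω v).card + 2 * n := by
  set I := Finset.Ico c (c + M)
  -- Cars move at most `n` by time `n`, so those from `I` park in `I` or in these two flanks of
  -- length `n`.
  set J := Finset.Ico (c - n) c ∪ Finset.Ico (c + M) (c + M + n)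
  set U := I.filter fun v => v ∈ (state ω n).unparked
  set S := I.filter fun v => IsSpot ω v
  set D := (I.filter fun v => IsCar ω v) \ U
  have hJ : J.card ≤ 2 * n := by
    refine (Finset.card_union_le _ _).trans ?_
    simp only [Int.card_Ico]
    omega
  have hD : D.card ≤ (S ∪ J).card := by
    have hp : ∀ v : ℤ, ∃ j : ℕ, v ∈ D → j < n ∧ ParksFrom ω (state ω j) (j + 1) v := by
      intro v
      by_cases hv : v ∈ D
      · simp only [D, U, Finset.mem_sdiff, Finset.mem_filter, not_and] at hv
        obtain ⟨j, -, h2, h3⟩ := exists_parksFrom (m := 0) (n := n) (v := v) hv.1.2 (hv.2 hv.1.1)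
        exact ⟨j, fun _ => ⟨h2, h3⟩⟩
      · exact ⟨0, fun h => absurd h hv⟩
    choose j hj using hp
    refine Finset.card_le_card_of_injOn (fun v => walk ω v (j v + 1)) ?_ ?_
    · intro v hv
      have hv' : v ∈ D := hv
      obtain ⟨h1, h2⟩ := hj v hv'
      have hs := isSpot_of_mem_vacant h2.2.1
      have hw := walk_mem_Icc ω v (j v + 1)
      simp only [D, Finset.mem_sdiff, Finset.mem_filter, I, Finset.mem_Ico] at hv'
      simp only [S, J, I, Finset.coe_union, Set.mem_union, Finset.mem_coe, Finset.mem_filter,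
        Finset.mem_Ico, hs, and_true, Set.mem_Icc] at hw ⊢
      omega
    · intro u hu v hv h
      exact parksFrom_inj (hj u hu).2 (hj v hv).2 h
  have h1 : (I.filter fun v => IsCar ω v).card ≤ U.card + D.card := by
    refine (Finset.card_le_card ?_).trans (Finset.card_union_le U D)
    intro v hv
    by_cases h : v ∈ U
    · exact Finset.mem_union_left _ h
    · exact Finset.mem_union_right _ (Finset.mem_sdiff.2 ⟨hv, h⟩)
  have h2 := Finset.card_union_le S J
  omega

/-- The walk from `v` visits the origin within `n` steps, staying in `[0, K]` until then. -/
def HitsOrigin (ω : Config) (K : ℤ) (n : ℕ) (v : ℤ) : Prop :=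
  ∃ k ≤ n, walk ω v k = 0 ∧ ∀ j ≤ k, walk ω v j ∈ Set.Icc 0 K

open Classical in
/-- As long as the spot at the origin is vacant, the unparked cars whose walks visit the origin
have to park on the way there. -/
lemma card_unparked_le_of_vacant (hω : NoTies ω) {m n : ℕ} (h0 : 0 ∈ (state ω n).vacant)
    (M K : ℕ) :
    ((Finset.Ico (1 : ℤ) (1 + M)).filter fun v => v ∈ (state ω m).unparked).card ≤
      ((Finset.Ico (1 : ℤ) (1 + M)).filter fun v => ¬ HitsOrigin ω K n v).card +
      ((Finset.Ico (1 : ℤ) (1 + K)).filter fun x => x ∈ (state ω m).vacant).card := by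
  set I := Finset.Ico (1 : ℤ) (1 + M)
  set U := I.filter fun v => v ∈ (state ω m).unparked
  set B := I.filter fun v => ¬ HitsOrigin ω K n v
  set V := (Finset.Ico (1 : ℤ) (1 + K)).filter fun x => x ∈ (state ω m).vacant
  have hD : (U \ B).card ≤ V.card := by
    have hp : ∀ v : ℤ, ∃ j : ℕ, v ∈ U \ B → ParksFrom ω (state ω j) (j + 1) v ∧
        walk ω v (j + 1) ∈ V := by
      intro v
      by_cases hv : v ∈ U \ B
      swap
      · exact ⟨0, fun h => absurd h hv⟩
      simp only [B, U, Finset.mem_sdiff, Finset.mem_filter, not_and, not_not] at hv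
      obtain ⟨⟨hvI, hvm⟩, hB⟩ := hv
      obtain ⟨k, hkn, hk0, hkI⟩ := hB hvI
      have hk : k ≠ 0 := by
        rintro rfl
        simp only [I, Finset.mem_Ico] at hvI
        simp [walk] at hk0
        omega
      obtain ⟨k, rfl⟩ := Nat.exists_eq_succ_of_ne_zero hk
      -- Arriving unparked at the origin would get its spot filled by time `n`, so the car parked
      -- strictly before this visit.
      have hnot : v ∉ (state ω k).unparked := fun h =>
        notMem_vacant_of_visit hω h hkn (hk0 ▸ h0)
      obtain ⟨j, hmj, hjk, hpark⟩ := exists_parksFrom hvm hnot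
      refine ⟨j, fun _ => ⟨hpark, ?_⟩⟩
      have hvac := vacant_antitone ω hmj hpark.2.1
      have hne : walk ω v (j + 1) ≠ 0 := fun h =>
        notMem_vacant_of_parksFrom hpark (by omega : j + 1 ≤ n) (h ▸ h0)
      have := hkI (j + 1) (by omega)
      simp only [Set.mem_Icc] at this
      simp only [V, Finset.mem_filter, Finset.mem_Ico]
      exact ⟨by omega, hvac⟩
    choose j hj using hp
    exact Finset.card_le_card_of_injOn (fun v => walk ω v (j v + 1)) (fun v hv => (hj v hv).2)
      fun u hu v hv h => parksFrom_inj (hj u hu).1 (hj v hv).1 h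
  have h1 : U.card ≤ B.card + (U \ B).card := by
    refine (Finset.card_le_card ?_).trans (Finset.card_union_le B (U \ B))
    intro v hv
    by_cases h : v ∈ B
    · exact Finset.mem_union_left _ h
    · exact Finset.mem_union_right _ (Finset.mem_sdiff.2 ⟨hv, h⟩)
  omega

lemma zero_mem_vacant_iff (ω : Config) (m : ℕ) :
    0 ∈ (state ω m).vacant ↔ IsSpot ω 0 ∧ ∀ n < m, ¬ FilledAt ω 0 n := by
  induction m with
  | zero => simp [state]
  | succ m ih =>
    change 0 ∈ (state ω m).vacant ∧ ¬ FilledAt ω 0 m ↔ _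
    rw [ih, Nat.forall_lt_succ_right, and_assoc]

/-- The time is an integer or infinite, so exceeding `t` means being at least `⌊t⌋₊ + 1`. `FilledAt`
with index `n` refers to time `n + 1`, which matches the vacancy criterion. -/
lemma lt_sigma_iff (ω : Config) {t : ℝ} (ht : 0 ≤ t) :
    ENNReal.ofReal t < (sigma ω : ℝ≥0∞) ↔ 0 ∈ (state ω ⌊t⌋₊).vacant := by
  rw [zero_mem_vacant_iff]
  by_cases h0 : IsSpot ω 0
  swap
  · simp [sigma, h0]
  simp only [h0, true_and, sigma, if_true]
  constructor
  · intro h n hn hfill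
    have h1 : (⨅ (n : ℕ) (_ : FilledAt ω 0 n), ((n + 1 : ℕ) : ℕ∞)) ≤ ((n + 1 : ℕ) : ℕ∞) :=
      iInf₂_le n hfill
    have h2 := h.trans_le (ENat.toENNReal_mono h1)
    rw [ENat.toENNReal_coe, ← ENNReal.ofReal_natCast, ENNReal.ofReal_lt_ofReal_iff (by positivity)]
      at h2
    have := (Nat.floor_lt ht).2 h2
    omega
  · intro h
    have h1 : ((⌊t⌋₊ + 1 : ℕ) : ℕ∞) ≤ ⨅ (n : ℕ) (_ : FilledAt ω 0 n), ((n + 1 : ℕ) : ℕ∞) := by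
      refine le_iInf₂ fun n hn => ?_
      have : ¬ n < ⌊t⌋₊ := fun hlt => h n hlt hn
      exact_mod_cast (by omega : ⌊t⌋₊ + 1 ≤ n + 1)
    refine lt_of_lt_of_le ?_ (ENat.toENNReal_mono h1)
    rw [ENat.toENNReal_coe, ← ENNReal.ofReal_natCast, ENNReal.ofReal_lt_ofReal_iff (by positivity)]
    push_cast
    exact Nat.lt_floor_add_one t

/-! ### Finite range of dependence at a fixed time -/

section Locality

/-- The state of a vertex at time `n` depends on the randomness within this distance. -/
def localRadius : ℕ → ℕ
  | 0 => 0
  | n + 1 => localRadius n + 2 * (n + 1)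

lemma walk_congr {ω ω' : Config} {v : ℤ} (h : ω v = ω' v) (n : ℕ) : walk ω v n = walk ω' v n := by
  simp [walk, h]

/-- Who parks at `x` at time `n + 1` is decided by vertices within `n + 1` of `x` and by states at
time `n`. Since a car also lands within `n + 1` of its start, `localRadius` grows by twice `n + 1`.
-/
lemma parksFrom_congr {ω ω' : Config} {n r : ℕ} {x : ℤ}
    (hx : ∀ y ∈ Set.Icc (x - (r + (n + 1))) (x + (r + (n + 1))), ω y = ω' y)
    (hloc : ∀ z, (∀ y ∈ Set.Icc (z - r : ℤ) (z + r), ω y = ω' y) →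
      (z ∈ (state ω n).unparked ↔ z ∈ (state ω' n).unparked) ∧
      (z ∈ (state ω n).vacant ↔ z ∈ (state ω' n).vacant)) {v : ℤ}
    (h : ParksFrom ω (state ω n) (n + 1) v ∧ walk ω v (n + 1) = x) :
    ParksFrom ω' (state ω' n) (n + 1) v ∧ walk ω' v (n + 1) = x := by
  obtain ⟨⟨h1, h2, h3⟩, h4⟩ := h
  have near : ∀ u : ℤ, x - (n + 1) ≤ u → u ≤ x + (n + 1) → ω u = ω' u ∧
      (u ∈ (state ω n).unparked ↔ u ∈ (state ω' n).unparked) := fun u hu hu' =>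
    ⟨hx u ⟨by omega, by omega⟩, (hloc u fun y hy => hx y ⟨by have := hy.1; omega,
      by have := hy.2; omega⟩).1⟩
  have hv := walk_mem_Icc ω v (n + 1)
  rw [h4, Set.mem_Icc] at hv
  push_cast at hv
  obtain ⟨nv1, nv2⟩ := near v (by omega) (by omega)
  have hw : walk ω' v (n + 1) = x := (walk_congr nv1 _).symm.trans h4
  refine ⟨⟨nv2.1 h1, ?_, fun u hu huv huw => ?_⟩, hw⟩
  · rw [hw]
    rw [h4] at h2
    exact (hloc x fun y hy => hx y ⟨by have := hy.1; omega, by have := hy.2; omega⟩).2.1 h2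
  · rw [hw] at huw
    have hu' := walk_mem_Icc ω' u (n + 1)
    rw [huw, Set.mem_Icc] at hu'
    push_cast at hu'
    obtain ⟨nu1, nu2⟩ := near u (by omega) (by omega)
    have := h3 u (nu2.2 hu) huv (by rw [walk_congr nu1, huw, h4])
    simpa [mark, nu1, nv1] using this

lemma state_congr (n : ℕ) {ω ω' : Config} {z : ℤ}
    (h : ∀ y ∈ Set.Icc (z - localRadius n : ℤ) (z + localRadius n), ω y = ω' y) :
    (z ∈ (state ω n).unparked ↔ z ∈ (state ω' n).unparked) ∧
      (z ∈ (state ω n).vacant ↔ z ∈ (state ω' n).vacant) := by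
  induction n generalizing ω ω' z with
  | zero =>
    have := h z (by simp [localRadius])
    simp [state, IsCar, IsSpot, this]
  | succ n ih =>
    have hr : (localRadius (n + 1) : ℤ) = localRadius n + 2 * (n + 1) := by
      simp [localRadius]
    rw [hr] at h
    have hz := ih (ω := ω) (ω' := ω') (z := z) fun y hy => h y ⟨by have := hy.1; omega,
      by have := hy.2; omega⟩
    have key : ∀ x : ℤ, z - (n + 1) ≤ x → x ≤ z + (n + 1) → ∀ v,
        (ParksFrom ω (state ω n) (n + 1) v ∧ walk ω v (n + 1) = x ↔
          ParksFrom ω' (state ω' n) (n + 1) v ∧ walk ω' v (n + 1) = x) := by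
      intro x hx1 hx2 v
      have hx : ∀ y ∈ Set.Icc (x - (localRadius n + (n + 1))) (x + (localRadius n + (n + 1))),
          ω y = ω' y := fun y hy => h y ⟨by have := hy.1; omega, by have := hy.2; omega⟩
      exact ⟨parksFrom_congr hx fun z hz => ih hz, parksFrom_congr (fun y hy => (hx y hy).symm)
        fun z hz => ih hz⟩
    constructor
    · have hw := walk_mem_Icc ω z (n + 1)
      rw [Set.mem_Icc] at hw
      push_cast at hw
      have e : walk ω' z (n + 1) = walk ω z (n + 1) :=
        (walk_congr (h z ⟨by omega, by omega⟩) _).symm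
      have := key (walk ω z (n + 1)) (by omega) (by omega) z
      rw [e] at this
      simp only [and_true] at this
      change _ ∧ ¬ _ ↔ _ ∧ ¬ _
      rw [hz.1, this]
    · change _ ∧ ¬ (∃ v, _) ↔ _ ∧ ¬ (∃ v, _)
      rw [hz.2, exists_congr (key z (by omega) (by omega))]

end Locality

/-! ### Translation covariance -/

section Shift

/-- Translation of a configuration. -/
def shift (c : ℤ) (ω : Config) : Config := fun v => ω (v + c)

lemma walk_shift (c : ℤ) (ω : Config) (v : ℤ) (n : ℕ) :
    walk (shift c ω) v n = walk ω (v + c) n - c := by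
  simp [walk, shift]; ring

lemma state_shift (c : ℤ) (ω : Config) (n : ℕ) :
    (∀ z, z ∈ (state (shift c ω) n).unparked ↔ z + c ∈ (state ω n).unparked) ∧
      ∀ z, z ∈ (state (shift c ω) n).vacant ↔ z + c ∈ (state ω n).vacant := by
  induction n with
  | zero => exact ⟨fun z => Iff.rfl, fun z => Iff.rfl⟩
  | succ n ih =>
    have key : ∀ v, ParksFrom (shift c ω) (state (shift c ω) n) (n + 1) v ↔
        ParksFrom ω (state ω n) (n + 1) (v + c) := by
      intro v
      unfold ParksFrom
      rw [ih.1, ih.2, walk_shift, sub_add_cancel]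
      refine and_congr_right fun _ => and_congr_right fun _ => ?_
      refine ⟨fun h u hu huv huw => ?_, fun h u hu huv huw => ?_⟩
      · have := h (u - c) ((ih.1 _).2 (by simpa using hu)) (by omega)
          (by rw [walk_shift]; simp [huw])
        simpa [mark, shift] using this
      · have := h (u + c) ((ih.1 _).1 hu) (by omega) (by rw [walk_shift] at huw; omega)
        simpa [mark, shift] using this
    constructor
    · intro z
      change _ ∧ ¬ _ ↔ _ ∧ ¬ _
      rw [ih.1, key]
    · intro z
      change _ ∧ ¬ (∃ v, _) ↔ _ ∧ ¬ (∃ v, _)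
      rw [ih.2]
      refine and_congr_right fun _ => not_congr ⟨?_, ?_⟩
      · rintro ⟨v, hv, hw⟩
        exact ⟨v + c, (key v).1 hv, by rw [walk_shift] at hw; omega⟩
      · rintro ⟨v, hv, hw⟩
        exact ⟨v - c, (key _).2 (by simpa using hv), by rw [walk_shift]; simp [hw]⟩

end Shift

/-! ### Measurability -/

section Measurability

lemma measurable_walk (v : ℤ) (n : ℕ) : Measurable fun ω : Config => walk ω v n :=
  measurable_const.add ((measurable_displacement n).comp
    (measurable_fst.comp (measurable_snd.comp (measurable_pi_apply v))))

lemma measurable_mark (v : ℤ) (n : ℕ) : Measurable fun ω : Config => mark ω v n :=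
  (measurable_pi_apply n).comp (measurable_snd.comp (measurable_snd.comp (measurable_pi_apply v)))

lemma measurable_type (v : ℤ) : Measurable fun ω : Config => (ω v).1 :=
  measurable_fst.comp (measurable_pi_apply v)

lemma measurableSet_isCar (v : ℤ) : MeasurableSet {ω | IsCar ω v} :=
  measurable_type v (measurableSet_singleton 1)

lemma measurableSet_isSpot (v : ℤ) : MeasurableSet {ω | IsSpot ω v} :=
  measurable_type v (measurableSet_singleton (-1))

lemma measurableSet_walk_eq (v x : ℤ) (n : ℕ) : MeasurableSet {ω | walk ω v n = x} :=
  measurable_walk v n (measurableSet_singleton x)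

lemma measurableSet_parksFrom {n : ℕ}
    (hU : ∀ v, MeasurableSet {ω | v ∈ (state ω n).unparked})
    (hV : ∀ x, MeasurableSet {ω | x ∈ (state ω n).vacant}) (v : ℤ) :
    MeasurableSet {ω | ParksFrom ω (state ω n) (n + 1) v} := by
  have e : {ω | ParksFrom ω (state ω n) (n + 1) v} = {ω | v ∈ (state ω n).unparked} ∩
      ((⋃ x : ℤ, {ω | walk ω v (n + 1) = x} ∩ {ω | x ∈ (state ω n).vacant}) ∩
      ⋂ u : ℤ, ({ω | u ∈ (state ω n).unparked}ᶜ ∪ ({_ω | u = v} ∪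
        ({ω | walk ω u (n + 1) = walk ω v (n + 1)}ᶜ ∪
          {ω | mark ω u (n + 1) < mark ω v (n + 1)})))) := by
    ext ω
    simp only [ParksFrom, Set.mem_ofPred_eq, Set.mem_inter_iff, Set.mem_iUnion, Set.mem_iInter,
      Set.mem_union, Set.mem_compl_iff]
    refine and_congr_right fun _ => and_congr ?_ (forall_congr' fun u => by tauto)
    exact ⟨fun h => ⟨_, rfl, h⟩, fun ⟨x, hx, h⟩ => hx ▸ h⟩
  rw [e]
  refine (hU v).inter ((MeasurableSet.iUnion fun x => (measurableSet_walk_eq v x _).inter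
    (hV x)).inter (MeasurableSet.iInter fun u => (hU u).compl.union
      ((MeasurableSet.const _).union ((measurableSet_eq_fun (measurable_walk u _)
        (measurable_walk v _)).compl.union
          (measurableSet_lt (measurable_mark u _) (measurable_mark v _))))))

lemma measurableSet_state (n : ℕ) :
    (∀ v, MeasurableSet {ω | v ∈ (state ω n).unparked}) ∧
      ∀ x, MeasurableSet {ω | x ∈ (state ω n).vacant} := by
  induction n with
  | zero => exact ⟨measurableSet_isCar, measurableSet_isSpot⟩
  | succ n ih =>
    have hp := measurableSet_parksFrom ih.1 ih.2
    refine ⟨fun v => (ih.1 v).inter (hp v).compl, fun x => (ih.2 x).inter ?_⟩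
    have e : {ω | ∃ v, ParksFrom ω (state ω n) (n + 1) v ∧ walk ω v (n + 1) = x} =
        ⋃ v, {ω | ParksFrom ω (state ω n) (n + 1) v} ∩ {ω | walk ω v (n + 1) = x} := by
      ext ω; simp
    have hm : MeasurableSet {ω | ∃ v, ParksFrom ω (state ω n) (n + 1) v ∧ walk ω v (n + 1) = x} := by
      rw [e]
      exact MeasurableSet.iUnion fun v => (hp v).inter (measurableSet_walk_eq v x _)
    exact hm.compl

lemma measurableSet_mem_unparked (n : ℕ) (v : ℤ) :
    MeasurableSet {ω | v ∈ (state ω n).unparked} := (measurableSet_state n).1 v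

lemma measurableSet_mem_vacant (n : ℕ) (x : ℤ) :
    MeasurableSet {ω | x ∈ (state ω n).vacant} := (measurableSet_state n).2 x

lemma measurableSet_exists_displacement (n : ℕ) (C : ℤ → Prop) (D : ℤ → Prop) :
    MeasurableSet {s | ∃ k ≤ n, C (displacement s k) ∧ ∀ j ≤ k, D (displacement s j)} := by
  have e : {s | ∃ k ≤ n, C (displacement s k) ∧ ∀ j ≤ k, D (displacement s j)} =
      ⋃ k ∈ Set.Iic n, ((fun s => displacement s k) ⁻¹' {z | C z} ∩
        ⋂ j ∈ Set.Iic k, (fun s => displacement s j) ⁻¹' {z | D z}) := by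
    ext s; simp [and_left_comm]
  rw [e]
  exact MeasurableSet.biUnion (Set.to_countable _) fun k _ =>
    (measurable_displacement k (Set.to_countable _).measurableSet).inter
      (MeasurableSet.biInter (Set.to_countable _) fun j _ =>
        measurable_displacement j (Set.to_countable _).measurableSet)

end Measurability

/-! ### Marginals, absence of ties, and translation invariance of the law -/

section Law

variable (p : unitInterval)

instance : IsProbabilityMeasure (parkingLaw p) := by unfold parkingLaw; infer_instance

lemma signLaw_real_one : (signLaw p).real {1} = p := by
  simp [signLaw, measureReal_def, p.2.1]

lemma signLaw_real_neg_one : (signLaw p).real {-1} = 1 - p := by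
  simp [signLaw, measureReal_def, p.2.2]

lemma measurePreserving_site (v : ℤ) :
    MeasurePreserving (fun ω : Config => ω v) (parkingLaw p) (siteLaw p) :=
  measurePreserving_eval_infinitePi (fun _ : ℤ => siteLaw p) v

lemma measurePreserving_steps_of_site :
    MeasurePreserving (fun s : Site => s.2.1) (siteLaw p) stepLaw :=
  measurePreserving_fst.comp measurePreserving_snd

lemma measurePreserving_steps (v : ℤ) :
    MeasurePreserving (fun ω : Config => (ω v).2.1) (parkingLaw p) stepLaw :=
  (measurePreserving_steps_of_site p).comp (measurePreserving_site p v)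

lemma measurePreserving_type_of_site :
    MeasurePreserving (fun s : Site => s.1) (siteLaw p) (signLaw p) :=
  measurePreserving_fst

lemma measurePreserving_mark (v : ℤ) (n : ℕ) :
    MeasurePreserving (fun ω : Config => mark ω v n) (parkingLaw p) volume :=
  ((measurePreserving_eval_infinitePi (fun _ : ℕ => (volume : Measure unitInterval)) n).comp
    (measurePreserving_snd.comp measurePreserving_snd)).comp (measurePreserving_site p v)

lemma measureReal_isCar (v : ℤ) : (parkingLaw p).real {ω | IsCar ω v} = p := by
  rw [← signLaw_real_one p]
  exact ((measurePreserving_type_of_site p).comp (measurePreserving_site p v)).measureReal_preimage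
    (measurableSet_singleton 1).nullMeasurableSet

lemma measureReal_isSpot (v : ℤ) : (parkingLaw p).real {ω | IsSpot ω v} = 1 - p := by
  rw [← signLaw_real_neg_one p]
  exact ((measurePreserving_type_of_site p).comp (measurePreserving_site p v)).measureReal_preimage
    (measurableSet_singleton (-1)).nullMeasurableSet

lemma ae_noTies : ∀ᵐ ω ∂(parkingLaw p), NoTies ω := by
  unfold NoTies
  rw [ae_all_iff]; intro n
  rw [ae_all_iff]; intro u
  rw [ae_all_iff]; intro v
  by_cases huv : u = v
  · exact ae_of_all _ fun ω h => absurd huv h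
  have hind : IndepFun (fun ω : Config => mark ω u n) (fun ω => mark ω v n) (parkingLaw p) := by
    refine indepFun_of_dependsOn (S := {u}) (T := {v}) _ (by simpa using huv)
      (measurable_mark u n) (measurable_mark v n) ?_ ?_
    · intro x y h
      simp [mark, h u (by simp)]
    · intro x y h
      simp [mark, h v (by simp)]
  have hlaw := (indepFun_iff_map_prod_eq_prod_map_map (measurable_mark u n).aemeasurable
    (measurable_mark v n).aemeasurable).1 hind
  rw [(measurePreserving_mark p u n).map_eq, (measurePreserving_mark p v n).map_eq] at hlaw
  have hdiag : ((volume : Measure unitInterval).prod volume) {z | z.1 = z.2} = 0 := by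
    rw [Measure.measure_prod_null (measurableSet_eq_fun measurable_fst measurable_snd)]
    refine ae_of_all _ fun x => ?_
    have : Prod.mk x ⁻¹' {z : unitInterval × unitInterval | z.1 = z.2} = {x} := by
      ext y; simp [eq_comm]
    simp only [this]
    simp
  have h0 : parkingLaw p {ω | mark ω u n = mark ω v n} = 0 := by
    rw [← hlaw, Measure.map_apply ((measurable_mark u n).prodMk (measurable_mark v n))
      (measurableSet_eq_fun measurable_fst measurable_snd)] at hdiag
    exact hdiag
  have := measure_eq_zero_iff_ae_notMem.1 h0
  filter_upwards [this] with ω hω _ h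
  exact hω h

lemma measurePreserving_shift (c : ℤ) :
    MeasurePreserving (shift c) (parkingLaw p) (parkingLaw p) := by
  have hm : Measurable (shift c) := measurable_pi_lambda _ fun v => measurable_pi_apply (v + c)
  refine ⟨hm, Measure.eq_infinitePi _ fun s t ht => ?_⟩
  classical
  rw [Measure.map_apply hm (MeasurableSet.pi s.countable_toSet fun i _ => ht i)]
  have e : shift c ⁻¹' (Set.pi s t) = Set.pi (s.map (addRightEmbedding c))
      fun v => t (v - c) := by
    ext ω
    simp only [Set.mem_preimage, Set.mem_pi, Finset.mem_coe, shift, Finset.mem_map,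
      addRightEmbedding_apply, forall_exists_index, and_imp]
    refine ⟨?_, fun h i hi => ?_⟩
    · rintro h _ i hi rfl
      simpa using h i hi
    · simpa using h (i + c) i hi rfl
  rw [e, parkingLaw, Measure.infinitePi_pi _ fun i _ => ht _]
  simp

lemma measureReal_mem_unparked (n : ℕ) (v : ℤ) :
    (parkingLaw p).real {ω | v ∈ (state ω n).unparked} =
      (parkingLaw p).real {ω | 0 ∈ (state ω n).unparked} := by
  rw [← (measurePreserving_shift p v).measureReal_preimage
    (measurableSet_mem_unparked n 0).nullMeasurableSet]
  congr 1
  ext ω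
  simp [(state_shift v ω n).1]

lemma measureReal_mem_vacant (n : ℕ) (x : ℤ) :
    (parkingLaw p).real {ω | x ∈ (state ω n).vacant} =
      (parkingLaw p).real {ω | 0 ∈ (state ω n).vacant} := by
  rw [← (measurePreserving_shift p x).measureReal_preimage
    (measurableSet_mem_vacant n 0).nullMeasurableSet]
  congr 1
  ext ω
  simp [(state_shift x ω n).2]

lemma measurableSet_hitsOrigin (K : ℤ) (n : ℕ) (v : ℤ) :
    MeasurableSet {ω | HitsOrigin ω K n v} :=
  (measurePreserving_steps 0 v).measurable
    (measurableSet_exists_displacement n (fun z => v + z = 0) (fun z => v + z ∈ Set.Icc 0 K))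

/-- A lower bound for the probability that the walk from `v` hits the origin. -/
lemma le_measureReal_hitsOrigin {v K : ℤ} (hv : 0 < v) (hK : 2 * v ≤ K) {n : ℕ} (hn : 0 < n) :
    1 - (v / K + (K : ℝ) ^ 2 / n) ≤ (parkingLaw p).real {ω | HitsOrigin ω K n v} := by
  have hm := measurableSet_exists_displacement n (fun z => z = -v)
    (fun z => z ∈ Set.Icc (-v) (K - v))
  -- Seen from `v`, the interval `[0, K]` has its ends at `-v` and `K - v`; `hK` says that the near
  -- end is the origin.
  have h := le_measureReal_hit hv (by omega : v ≤ K - v) hn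
  rw [← (measurePreserving_steps p v).measureReal_preimage hm.nullMeasurableSet] at h
  refine le_trans ?_ (h.trans (measureReal_mono ?_))
  · have hv' : (0 : ℝ) < v := by exact_mod_cast hv
    have hK' : 2 * (v : ℝ) ≤ K := by exact_mod_cast hK
    have hn' : (0 : ℝ) < n := by exact_mod_cast hn
    push_cast
    have e : (v : ℝ) + (K - v) = K := by ring
    rw [e, sub_div, div_self (by linarith : (K : ℝ) ≠ 0)]
    have : ((K : ℝ) - v) ^ 2 / n ≤ (K : ℝ) ^ 2 / n := by
      gcongr
      · linarith
      · linarith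
    linarith
  · rintro ω ⟨k, hk, hk0, hkI⟩
    refine ⟨k, hk, ?_, fun j hj => ?_⟩
    · rw [walk_eq, hk0]; ring
    · have := hkI j hj
      simp only [Set.mem_Icc] at this
      rw [walk_eq, Set.mem_Icc]
      omega

end Law

/-! ### The vacancy probability tends to zero -/

variable (p : unitInterval)

lemma measureReal_le_of_noTies {S E : Set Config} (h : ∀ ω, NoTies ω → ω ∈ S → ω ∈ E) :
    (parkingLaw p).real S ≤ (parkingLaw p).real E := by
  refine ENNReal.toReal_mono (measure_ne_top _ _) (measure_mono_ae ?_)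
  filter_upwards [ae_noTies p] with ω hω hS
  exact h ω hω hS

lemma dependsOn_vacant (n : ℕ) (x : ℤ) :
    DependsOn (fun ω : Config => ω ∈ {ω | x ∈ (state ω n).vacant})
      (Finset.Icc (x - localRadius n) (x + localRadius n) : Set ℤ) := by
  intro ω ω' h
  exact propext (state_congr n fun y hy => h y (by simpa using hy)).2

lemma measureReal_vacant_antitone :
    Antitone fun n => (parkingLaw p).real {ω | 0 ∈ (state ω n).vacant} := fun _ _ h =>
  measureReal_mono fun ω hω => vacant_antitone ω h hω

/-- The surplus of cars over spots never parks. -/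
lemma le_measureReal_unparked (n : ℕ) :
    2 * (p : ℝ) - 1 ≤ (parkingLaw p).real {ω | 0 ∈ (state ω n).unparked} := by
  classical
  set u := (parkingLaw p).real {ω | 0 ∈ (state ω n).unparked} with hu
  -- The expected count over an interval of length `M` has a boundary error `2 * n` independent of
  -- `M`, so a positive bracket is impossible for large `M`.
  have key : ∀ M : ℕ, (M : ℝ) * (2 * p - 1 - u) ≤ 2 * n := by
    intro M
    set I := Finset.Ico (0 : ℤ) (0 + M)
    have hI : I.card = M := by simp [I]
    have i1 := integrable_card_filter (P := parkingLaw p) I measurableSet_isCar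
    have i2 := integrable_card_filter (P := parkingLaw p) I (measurableSet_mem_unparked n)
    have i3 := integrable_card_filter (P := parkingLaw p) I measurableSet_isSpot
    have h := integral_mono i1 ((i2.add i3).add (integrable_const (2 * n : ℝ))) fun ω => by
      have := card_isCar_le ω 0 M n
      simp only [Pi.add_apply]
      exact_mod_cast this
    rw [integral_add' (i2.add i3) (integrable_const _), integral_add' i2 i3,
      integral_card_filter I measurableSet_isCar,
      integral_card_filter I (measurableSet_mem_unparked n),
      integral_card_filter I measurableSet_isSpot] at h
    simp only [measureReal_isCar, measureReal_isSpot, measureReal_mem_unparked, Finset.sum_const,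
      hI, nsmul_eq_mul, integral_const, probReal_univ, smul_eq_mul, one_mul] at h
    linarith
  by_contra hcon
  push Not at hcon
  obtain ⟨M, hM⟩ := exists_nat_gt (2 * (n : ℝ) / (2 * (p : ℝ) - 1 - u))
  rw [div_lt_iff₀ (by linarith)] at hM
  linarith [key M]

lemma exists_le_exp_neg_mul {C c ε : ℝ} (hc : 0 < c) (hε : 0 < ε) :
    ∃ N : ℕ, 0 < N ∧ C * Real.exp (-c * N) ≤ ε := by
  have h : Filter.Tendsto (fun N : ℕ => C * Real.exp (-c * N)) Filter.atTop (nhds (C * 0)) := by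
    refine Filter.Tendsto.const_mul C (Real.tendsto_exp_atBot.comp ?_)
    exact tendsto_natCast_atTop_atTop.const_mul_atTop_of_neg (by linarith)
  rw [mul_zero] at h
  obtain ⟨N, h1, h2⟩ := ((h.eventually_le_const hε).and (Filter.eventually_gt_atTop 0)).exists
  exact ⟨N, h2, h1⟩

/-- The walk from the origin visits all sites of an interval, if given enough time. -/
lemma exists_measureReal_notVisited_le (M : ℕ) {ε : ℝ} (hε : 0 < ε) :
    ∃ n₁, ∀ n ≥ n₁, (parkingLaw p).real {ω | ∃ x ∈ Finset.Ico (-M : ℤ) 0,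
      ∀ k ≤ n, walk ω 0 k ≠ x} ≤ ε := by
  -- A union bound over `M` sites: `K` makes `M ^ 2 / K` at most `ε / 2`, and then `n₁` does the
  -- same for `M * K ^ 2 / n`.
  obtain ⟨K, hK⟩ := exists_nat_gt (max (2 * M) (2 * M ^ 2 / ε) : ℝ)
  have hK1 : (2 * M : ℝ) < K := (le_max_left _ _).trans_lt hK
  have hK0 : (0 : ℝ) < K := lt_of_le_of_lt (by positivity) hK1
  have hK2 : (2 * M ^ 2 : ℝ) < K * ε := (div_lt_iff₀ hε).1 ((le_max_right _ _).trans_lt hK)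
  obtain ⟨n₁, hn₁⟩ := exists_nat_gt (2 * M * K ^ 2 / ε : ℝ)
  refine ⟨n₁, fun n hn => ?_⟩
  have hn' : (2 * M * K ^ 2 / ε : ℝ) < n := hn₁.trans_le (by exact_mod_cast hn)
  have hn0 : (0 : ℝ) < n := lt_of_le_of_lt (by positivity) hn'
  rw [div_lt_iff₀ hε] at hn'
  set A : ℤ → Set Config := fun x => {ω | shift x ω ∈ {ω | HitsOrigin ω K n (-x)}ᶜ}
  have hA : ∀ x ∈ Finset.Ico (-M : ℤ) 0,
      (parkingLaw p).real (A x) ≤ M / K + (K : ℝ) ^ 2 / n := by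
    intro x hx
    rw [Finset.mem_Ico] at hx
    have hm := measurableSet_hitsOrigin K n (-x)
    have h1 : (parkingLaw p).real (A x) = (parkingLaw p).real {ω | HitsOrigin ω K n (-x)}ᶜ :=
      (measurePreserving_shift p x).measureReal_preimage hm.compl.nullMeasurableSet
    rw [h1, probReal_compl_eq_one_sub hm]
    have hKM : 2 * (M : ℤ) ≤ K := by exact_mod_cast hK1.le
    have h2 := le_measureReal_hitsOrigin p (v := -x) (K := K) (by omega) (by omega)
      (by exact_mod_cast hn0 : 0 < n)
    have h3 : ((-x : ℤ) : ℝ) / (K : ℤ) ≤ M / K := by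
      have : ((-x : ℤ) : ℝ) ≤ M := by exact_mod_cast (by omega : -x ≤ (M : ℤ))
      push_cast at this ⊢
      gcongr
    push_cast at h2 h3 ⊢
    linarith
  have hsub : {ω : Config | ∃ x ∈ Finset.Ico (-M : ℤ) 0, ∀ k ≤ n, walk ω 0 k ≠ x} ⊆
      ⋃ x ∈ Finset.Ico (-M : ℤ) 0, A x := by
    rintro ω ⟨x, hx, hω⟩
    refine Set.mem_biUnion hx ?_
    rintro ⟨k, hk, hk0, -⟩
    refine hω k hk ?_
    rw [walk_shift] at hk0
    simp only [neg_add_cancel] at hk0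
    omega
  calc _ ≤ (parkingLaw p).real _ := measureReal_mono hsub (measure_ne_top _ _)
    _ ≤ ∑ x ∈ Finset.Ico (-M : ℤ) 0, (parkingLaw p).real (A x) := measureReal_biUnion_finset_le _ _
    _ ≤ ∑ x ∈ Finset.Ico (-M : ℤ) 0, (M / K + (K : ℝ) ^ 2 / n) := Finset.sum_le_sum hA
    _ = M ^ 2 / K + M * K ^ 2 / n := by simp; ring
    _ ≤ ε / 2 + ε / 2 := by
        refine add_le_add ?_ ?_
        · rw [div_le_div_iff₀ hK0 two_pos]; linarith
        · rw [div_le_div_iff₀ hn0 two_pos]; linarith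
    _ = ε := by ring

open Classical in
/-- Markov's inequality for the number of occurrences among events. -/
lemma measureReal_card_ge_le_div {Ω κ : Type*} [MeasurableSpace Ω] {P : Measure Ω}
    [IsProbabilityMeasure P] (s : Finset κ) {A : κ → Set Ω} (hA : ∀ k, MeasurableSet (A k))
    {a q : ℝ} (ha : 0 < a) (hq : ∀ k ∈ s, P.real (A k) ≤ q) :
    P.real {ω | a ≤ ((s.filter fun k => ω ∈ A k).card : ℝ)} ≤ s.card * q / a := by
  have h := mul_meas_ge_le_integral_of_nonneg (ae_of_all _ fun ω => Nat.cast_nonneg _)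
    (integrable_card_filter (P := P) s hA) a
  rw [integral_card_filter s hA] at h
  rw [le_div_iff₀ ha, mul_comm]
  refine h.trans ?_
  simpa using Finset.sum_le_card_nsmul s _ _ hq

/-- The site `x` holds no vacant spot at time `n`. -/
def notVacant (n : ℕ) (x : ℤ) : Set Config := {ω | x ∈ (state ω n).vacant}ᶜ

lemma measurableSet_notVacant (n : ℕ) (x : ℤ) : MeasurableSet (notVacant n x) :=
  (measurableSet_mem_vacant n x).compl

/-- The spot at `x` is vacant at time `m` but not at time `n`. -/
def filledBetween (m n : ℕ) (x : ℤ) : Set Config :=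
  {ω | x ∈ (state ω m).vacant} \ {ω | x ∈ (state ω n).vacant}

lemma measurableSet_filledBetween (m n : ℕ) (x : ℤ) : MeasurableSet (filledBetween m n x) :=
  (measurableSet_mem_vacant m x).diff (measurableSet_mem_vacant n x)

lemma measureReal_filledBetween {m n : ℕ} (h : m ≤ n) (x : ℤ) :
    (parkingLaw p).real (filledBetween m n x) =
      (parkingLaw p).real {ω | 0 ∈ (state ω m).vacant} -
        (parkingLaw p).real {ω | 0 ∈ (state ω n).vacant} := by
  have hsub : {ω | x ∈ (state ω n).vacant} ⊆ {ω | x ∈ (state ω m).vacant} :=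
    fun ω hω => vacant_antitone ω h hω
  rw [filledBetween, measureReal_sdiff hsub (measurableSet_mem_vacant n x),
    measureReal_mem_vacant p m x, measureReal_mem_vacant p n x]

open Classical in
/-- If many spots of an interval are vacant at time `m`, few of these get filled between `m` and
`n`, and the walk from the origin has visited the interval by time `n`, then the car from the
origin has parked. -/
lemma notMem_unparked_of_card_lt {ω : Config} (hω : NoTies ω) {m n M : ℕ} {a b : ℝ}
    (hab : a + b ≤ M)
    (h1 : (((Finset.Ico (-M : ℤ) 0).filter fun x => ω ∈ notVacant m x).card : ℝ) < a)
    (h2 : (((Finset.Ico (-M : ℤ) 0).filter fun x => ω ∈ filledBetween m n x).card : ℝ) < b)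
    (h3 : ∀ x ∈ Finset.Ico (-M : ℤ) 0, ∃ k ≤ n, walk ω 0 k = x) :
    0 ∉ (state ω n).unparked := by
  intro h0
  set I := Finset.Ico (-M : ℤ) 0
  have hIc : I.card = M := by simp [I]
  have hnone : ∀ x ∈ I, x ∉ (state ω n).vacant := by
    intro x hx hxv
    obtain ⟨k, hk, hkx⟩ := h3 x hx
    have hk0 : k ≠ 0 := by
      rintro rfl
      simp [walk] at hkx
      simp [I, ← hkx] at hx
    obtain ⟨k, rfl⟩ := Nat.exists_eq_succ_of_ne_zero hk0
    exact notMem_vacant_of_visit hω (unparked_antitone ω (by omega : k ≤ n) h0) hk (hkx ▸ hxv)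
  have hle : I.card ≤ (I.filter fun x => ω ∈ notVacant m x).card +
      (I.filter fun x => ω ∈ filledBetween m n x).card := by
    refine (Finset.card_le_card fun x hx => ?_).trans (Finset.card_union_le _ _)
    have := hnone x hx
    simp only [Finset.mem_union, Finset.mem_filter, hx, true_and, notVacant, filledBetween,
      Set.mem_compl_iff, Set.mem_sdiff, Set.mem_ofPred_eq]
    tauto
  rw [hIc] at hle
  have : (M : ℝ) ≤ ((I.filter fun x => ω ∈ notVacant m x).card : ℝ) +
      ((I.filter fun x => ω ∈ filledBetween m n x).card : ℝ) := by exact_mod_cast hle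
  linarith

open Classical in
-- By contradiction: a persistent density of vacant spots would leave the car from the origin
-- unparked with probability at most `3δ / 4`, below the surplus `δ`.
lemma exists_measureReal_vacant_le (hp : (1 / 2 : ℝ) < p) {ε : ℝ} (hε : 0 < ε) :
    ∃ n, (parkingLaw p).real {ω | 0 ∈ (state ω n).vacant} ≤ ε := by
  by_contra! hcon
  set w : ℕ → ℝ := fun n => (parkingLaw p).real {ω | 0 ∈ (state ω n).vacant} with hw
  set δ : ℝ := 2 * p - 1 with hδ
  have hδ0 : 0 < δ := by linarith
  have hbdd : BddBelow (Set.range w) := ⟨0, by rintro _ ⟨n, rfl⟩; exact measureReal_nonneg⟩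
  -- The vacancy probabilities decrease to a limit, so after `n₀` they lose at most `ε * δ / 8`.
  -- Markov's inequality at level `M * (ε / 2)` turns this loss into the `δ / 4` for `E₂`.
  obtain ⟨n₀, hn₀⟩ := exists_lt_of_ciInf_lt
    (show ⨅ n, w n < (⨅ n, w n) + ε * δ / 8 by linarith [show 0 < ε * δ / 8 by positivity])
  have hη : ∀ n, w n₀ - w n ≤ ε * δ / 8 := fun n => by linarith [ciInf_le hbdd n]
  set r := localRadius n₀
  obtain ⟨N, hN0, hN⟩ := exists_le_exp_neg_mul (C := 2 * r + 1) (c := 2 * (ε / 2) ^ 2)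
    (ε := δ / 4) (by positivity) (by positivity)
  set M : ℕ := N * (2 * r + 1) with hM
  have hM0 : (0 : ℝ) < M := by
    have : 0 < M := by positivity
    exact_mod_cast this
  set I := Finset.Ico (-M : ℤ) 0 with hI
  have hIc : I.card = M := by simp [hI]
  set E₁ : Set Config := {ω | (M : ℝ) * (1 - ε + ε / 2) ≤
    ((I.filter fun x => ω ∈ notVacant n₀ x).card : ℝ)}
  have hE₁ : (parkingLaw p).real E₁ ≤ δ / 4 := by
    have h := infinitePi_card_ge_le (siteLaw p) r (A := notVacant n₀)
      (measurableSet_notVacant n₀)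
      (fun x ω ω' h => by
        have := dependsOn_vacant n₀ x h
        simp only [notVacant, Set.mem_compl_iff, this])
      (q := 1 - ε) (δ := ε / 2) (by positivity) (-M) N (fun x _ => by
        change (parkingLaw p).real _ ≤ _
        rw [notVacant, probReal_compl_eq_one_sub (measurableSet_mem_vacant n₀ x),
          measureReal_mem_vacant]
        linarith [hcon n₀])
    have e : (-M + N * (2 * r + 1) : ℤ) = 0 := by simp [hM]
    have e2 : (N * (2 * r + 1) : ℝ) = M := by simp [hM]
    rw [e, e2] at h
    refine le_trans h (le_trans (le_of_eq ?_) hN)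
    rw [neg_mul]
  obtain ⟨n₁, hn₁⟩ := exists_measureReal_notVisited_le p M (ε := δ / 4) (by positivity)
  set n := max n₀ n₁
  have hnn : n₀ ≤ n := le_max_left _ _
  set E₃ : Set Config := {ω | ∃ x ∈ I, ∀ k ≤ n, walk ω 0 k ≠ x}
  have hE₃ : (parkingLaw p).real E₃ ≤ δ / 4 := hn₁ n (le_max_right _ _)
  set E₂ : Set Config :=
    {ω | (M : ℝ) * (ε / 2) ≤ ((I.filter fun x => ω ∈ filledBetween n₀ n x).card : ℝ)}
  have hE₂ : (parkingLaw p).real E₂ ≤ δ / 4 := by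
    have h := measureReal_card_ge_le_div (P := parkingLaw p) I
      (measurableSet_filledBetween n₀ n) (a := M * (ε / 2)) (q := ε * δ / 8) (by positivity)
      (fun x _ => (measureReal_filledBetween p hnn x).trans_le (hη n))
    refine h.trans (le_of_eq ?_)
    rw [hIc]
    field_simp
    norm_num
  have hmain : (parkingLaw p).real {ω | 0 ∈ (state ω n).unparked} ≤
      (parkingLaw p).real (E₁ ∪ E₂ ∪ E₃) := by
    refine measureReal_le_of_noTies p fun ω hω h0 => ?_
    by_contra hE
    simp only [Set.mem_union, not_or] at hE
    obtain ⟨⟨h1, h2⟩, h3⟩ := hE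
    refine notMem_unparked_of_card_lt hω (le_of_eq ?_) (not_le.1 h1) (not_le.1 h2)
      (fun x hx => ?_) h0
    · ring
    · by_contra hx'
      exact h3 ⟨x, hx, fun k hk hkx => hx' ⟨k, hk, hkx⟩⟩
  have := le_measureReal_unparked p n
  have h4 := measureReal_union_le (μ := parkingLaw p) (E₁ ∪ E₂) E₃
  have h5 := measureReal_union_le (μ := parkingLaw p) E₁ E₂
  linarith

/-! ### Exponential decay along a sequence of squares -/

open Classical in
/-- If an interval has a surplus of cars, most walks from the interval visit the origin, and few
spots nearby are vacant at time `m`, then the spot at the origin is not vacant. -/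
lemma notMem_vacant_of_card_lt {ω : Config} (hω : NoTies ω) {m n M K : ℕ} {a b c : ℝ}
    (hab : 2 * a + b + c + 2 * m ≤ M)
    (h1 : (((Finset.Ico (1 : ℤ) (1 + M)).filter fun v => IsSpot ω v).card : ℝ) < a)
    (h2 : (((Finset.Ico (1 : ℤ) (1 + M)).filter fun v => ¬ HitsOrigin ω K n v).card : ℝ) < b)
    (h3 : (((Finset.Ico (1 : ℤ) (1 + K)).filter fun x => x ∈ (state ω m).vacant).card : ℝ) < c) :
    0 ∉ (state ω n).vacant := by
  intro h0
  have k1 := card_unparked_le_of_vacant (m := m) hω h0 M K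
  have k2 := card_isCar_le ω 1 M m
  have k3 : M ≤ ((Finset.Ico (1 : ℤ) (1 + M)).filter fun v => IsCar ω v).card +
      ((Finset.Ico (1 : ℤ) (1 + M)).filter fun v => IsSpot ω v).card := by
    have : (Finset.Ico (1 : ℤ) (1 + M)).card = M := by simp
    refine this.symm.trans_le ((Finset.card_le_card fun v hv => ?_).trans
      (Finset.card_union_le _ _))
    have := isCar_or_isSpot ω v
    simp only [Finset.mem_union, Finset.mem_filter, hv, true_and]
    exact this
  have k4 : M ≤ ((Finset.Ico (1 : ℤ) (1 + M)).filter fun v => ¬ HitsOrigin ω K n v).card +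
      ((Finset.Ico (1 : ℤ) (1 + K)).filter fun x => x ∈ (state ω m).vacant).card +
      2 * ((Finset.Ico (1 : ℤ) (1 + M)).filter fun v => IsSpot ω v).card + 2 * m := by omega
  have k5 : (M : ℝ) ≤
      (((Finset.Ico (1 : ℤ) (1 + M)).filter fun v => ¬ HitsOrigin ω K n v).card : ℝ) +
      (((Finset.Ico (1 : ℤ) (1 + K)).filter fun x => x ∈ (state ω m).vacant).card : ℝ) +
      2 * (((Finset.Ico (1 : ℤ) (1 + M)).filter fun v => IsSpot ω v).card : ℝ) + 2 * m := by
    exact_mod_cast k4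
  linarith

open Classical in
lemma measureReal_card_isSpot_ge_le (M : ℕ) {η : ℝ} (hη : 0 ≤ η) :
    (parkingLaw p).real {ω | (M : ℝ) * (1 - p + η) ≤
      (((Finset.Ico (1 : ℤ) (1 + M)).filter fun v => IsSpot ω v).card : ℝ)} ≤
      Real.exp (-2 * η ^ 2 * M) := by
  have h := infinitePi_card_ge_le (siteLaw p) 0 (A := fun v => {ω | IsSpot ω v})
    measurableSet_isSpot (fun v ω ω' h => by
      have := h v (by simp)
      simp [IsSpot, this]) (q := 1 - p) hη 1 M (fun v _ => (measureReal_isSpot p v).le)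
  simpa [parkingLaw] using h

open Classical in
lemma measureReal_card_not_hitsOrigin_ge_le (M K n : ℕ) {q η : ℝ} (hη : 0 ≤ η)
    (hq : ∀ v ∈ Finset.Ico (1 : ℤ) (1 + M), 1 - q ≤ (parkingLaw p).real {ω | HitsOrigin ω K n v}) :
    (parkingLaw p).real {ω | M * (q + η) ≤
      (((Finset.Ico (1 : ℤ) (1 + M)).filter fun v => ¬ HitsOrigin ω K n v).card : ℝ)} ≤
      Real.exp (-2 * η ^ 2 * M) := by
  have h := infinitePi_card_ge_le (siteLaw p) 0 (A := fun v => {ω | ¬ HitsOrigin ω K n v})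
    (fun v => (measurableSet_hitsOrigin K n v).compl) (fun v ω ω' h => by
      have := h v (by simp)
      simp [HitsOrigin, walk_congr this]) (q := q) hη 1 M (fun v hv => by
        have h1 := hq v (by simpa using hv)
        have h2 := probReal_compl_eq_one_sub (μ := parkingLaw p) (measurableSet_hitsOrigin K n v)
        change (parkingLaw p).real {ω | HitsOrigin ω K n v}ᶜ ≤ q
        linarith)
  simpa [parkingLaw] using h

open Classical in
lemma measureReal_card_vacant_ge_le (m N : ℕ) {q η : ℝ} (hη : 0 ≤ η)
    (hq : (parkingLaw p).real {ω | 0 ∈ (state ω m).vacant} ≤ q) :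
    (parkingLaw p).real {ω | ((N * (2 * localRadius m + 1) : ℕ) : ℝ) * (q + η) ≤
      (((Finset.Ico (1 : ℤ) (1 + (N * (2 * localRadius m + 1) : ℕ))).filter
        fun x => x ∈ (state ω m).vacant).card : ℝ)} ≤
      (2 * localRadius m + 1) * Real.exp (-2 * η ^ 2 * N) := by
  have h := infinitePi_card_ge_le (siteLaw p) (localRadius m)
    (A := fun x => {ω | x ∈ (state ω m).vacant}) (measurableSet_mem_vacant m)
    (dependsOn_vacant m) (q := q) hη 1 N (fun x _ => (measureReal_mem_vacant p m x).trans_le hq)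
  simpa [parkingLaw] using h

lemma exp_neg_two_sq_mul_le {c η x y : ℝ} (hx : 0 ≤ x) (hxy : x ≤ y) (hc : c ≤ 2 * η ^ 2) :
    Real.exp (-2 * η ^ 2 * y) ≤ Real.exp (-c * x) := by
  refine Real.exp_le_exp.2 ?_
  have : c * x ≤ 2 * η ^ 2 * y := mul_le_mul hc hxy hx (by positivity)
  linarith

lemma one_sub_le_measureReal_hitsOrigin {δ : ℝ} {B M : ℕ} (hB2 : (2 : ℝ) < B)
    (hBδ : 16 < B * δ) (hM0 : (0 : ℝ) < M) {v : ℤ} (hv : v ∈ Finset.Ico (1 : ℤ) (1 + M)) :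
    1 - δ / 8 ≤ (parkingLaw p).real {ω | HitsOrigin ω ((B * M : ℕ) : ℤ) ((B ^ 2 * M) ^ 2) v} := by
  rw [Finset.mem_Ico] at hv
  have hB0 : (0 : ℝ) < B := by linarith
  have hvM : (v : ℝ) ≤ M := by exact_mod_cast (by omega : v ≤ (M : ℤ))
  have h2v : 2 * v ≤ ((B * M : ℕ) : ℤ) := by
    have : 2 * (v : ℝ) ≤ (B * M : ℕ) := by push_cast; nlinarith
    exact_mod_cast this
  have hn0 : 0 < (B ^ 2 * M) ^ 2 := by
    have : (0 : ℝ) < ((B ^ 2 * M) ^ 2 : ℕ) := by push_cast; positivity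
    exact_mod_cast this
  refine le_trans ?_ (le_measureReal_hitsOrigin p (by omega) h2v hn0)
  push_cast
  have h1 : (v : ℝ) / (B * M) ≤ δ / 16 := by
    rw [div_le_div_iff₀ (by positivity) (by norm_num)]
    calc (v : ℝ) * 16 ≤ M * (B * δ) := mul_le_mul hvM hBδ.le (by norm_num) hM0.le
      _ = δ * (B * M) := by ring
  have h2 : ((B : ℝ) * M) ^ 2 / (B ^ 2 * M) ^ 2 ≤ δ / 16 := by
    rw [div_le_div_iff₀ (by positivity) (by norm_num)]
    have e : δ * ((B : ℝ) ^ 2 * M) ^ 2 = (B * M) ^ 2 * ((B * δ) * B) := by ring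
    rw [e]
    refine mul_le_mul_of_nonneg_left ?_ (sq_nonneg _)
    nlinarith
  linarith

/-- The upper bound along the squares of the multiples of a fixed integer. -/
lemma exists_measureReal_vacant_sq_le (hp : (1 / 2 : ℝ) < p) :
    ∃ (C c : ℝ) (g N₀ : ℕ), 0 < c ∧ 0 < g ∧ ∀ N ≥ N₀,
      (parkingLaw p).real {ω | 0 ∈ (state ω ((g * N) ^ 2)).vacant} ≤ C * Real.exp (-c * N) := by
  classical
  set δ : ℝ := 2 * p - 1 with hδ
  have hδ0 : 0 < δ := by linarith
  -- With `K = B * M` and `n = (B ^ 2 * M) ^ 2`, the errors `v / K ≤ 1 / B` and `K ^ 2 / n = 1 / B ^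
  -- 2` are each at most `δ / 16`.
  obtain ⟨B, hB⟩ := exists_nat_gt (max 2 (16 / δ))
  have hB2 : (2 : ℝ) < B := (le_max_left _ _).trans_lt hB
  have hB0 : (0 : ℝ) < B := by linarith
  have hBδ : 16 < B * δ := (div_lt_iff₀ hδ0).1 ((le_max_right _ _).trans_lt hB)
  -- Chosen so that the threshold `K * (ε + ε)` for vacant spots equals `M * δ / 8`.
  set ε : ℝ := δ / (16 * B) with hε
  have hε0 : 0 < ε := by positivity
  obtain ⟨s, hs⟩ := exists_measureReal_vacant_le p hp hε0
  set m : ℕ := 2 * localRadius s + 1 with hm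
  have hm1 : (1 : ℝ) ≤ m := by simp [hm]
  -- The thresholds for spots (counted twice), missing walks and vacant spots add up to `M * (1 - 3
  -- * δ / 8)`; the rest must absorb the boundary term `2 * s`.
  obtain ⟨N₁, hN₁⟩ := exists_nat_gt (16 * s / (3 * δ) : ℝ)
  rw [div_lt_iff₀ (by positivity)] at hN₁
  set c : ℝ := min (2 * (δ / 8) ^ 2) (2 * ε ^ 2) with hc
  refine ⟨2 + m, c, B ^ 2 * m, N₁ + 1, lt_min (by positivity) (by positivity), ?_, ?_⟩
  · have : 0 < B := by exact_mod_cast hB0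
    positivity
  intro N hN
  set M : ℕ := N * m with hM
  set K : ℕ := B * M with hK
  have hn : (B ^ 2 * m * N) ^ 2 = (B ^ 2 * M) ^ 2 := by rw [hM]; ring
  rw [hn]
  set n : ℕ := (B ^ 2 * M) ^ 2
  have hNN : (N₁ : ℝ) + 1 ≤ N := by exact_mod_cast hN
  have hN0 : (0 : ℝ) < N := by linarith [(Nat.cast_nonneg N₁ : (0 : ℝ) ≤ N₁)]
  have hMN : (N : ℝ) ≤ M := by
    simp only [hM, Nat.cast_mul]; nlinarith
  have hM0 : (0 : ℝ) < M := by linarith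
  have hKr : (K : ℝ) = B * M := by simp [hK]
  have hKeq : K = (B * N) * m := by simp [hK, hM]; ring
  have hhit : ∀ v ∈ Finset.Ico (1 : ℤ) (1 + M),
      1 - δ / 8 ≤ (parkingLaw p).real {ω | HitsOrigin ω K n v} :=
    fun v hv => one_sub_le_measureReal_hitsOrigin p hB2 hBδ hM0 hv
  have e₁ := measureReal_card_isSpot_ge_le p M (η := δ / 8) (by positivity)
  have e₂ := measureReal_card_not_hitsOrigin_ge_le p M K n (η := δ / 8) (by positivity) hhit
  have e₃ := measureReal_card_vacant_ge_le p s (B * N) hε0.le hs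
  have hmr : (2 * (localRadius s : ℝ) + 1) = m := by simp [hm]
  rw [← hm, ← hKeq, hmr] at e₃
  set E₁ := {ω : Config | (M : ℝ) * (1 - p + δ / 8) ≤
      (((Finset.Ico (1 : ℤ) (1 + M)).filter fun v => IsSpot ω v).card : ℝ)}
  set E₂ := {ω : Config | (M : ℝ) * (δ / 8 + δ / 8) ≤
      (((Finset.Ico (1 : ℤ) (1 + M)).filter fun v => ¬ HitsOrigin ω K n v).card : ℝ)}
  set E₃ := {ω : Config | (K : ℝ) * (ε + ε) ≤
      (((Finset.Ico (1 : ℤ) (1 + K)).filter fun x => x ∈ (state ω s).vacant).card : ℝ)}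
  have hmain : (parkingLaw p).real {ω | 0 ∈ (state ω n).vacant} ≤
      (parkingLaw p).real (E₁ ∪ E₂ ∪ E₃) := by
    refine measureReal_le_of_noTies p fun ω hω h0 => ?_
    by_contra hE
    simp only [Set.mem_union, not_or] at hE
    obtain ⟨⟨h1, h2⟩, h3⟩ := hE
    refine notMem_vacant_of_card_lt hω ?_ (not_le.1 h1) (not_le.1 h2) (not_le.1 h3) h0
    have hKε : (K : ℝ) * (ε + ε) = M * δ / 8 := by
      rw [hKr, hε]; field_simp; norm_num
    rw [hKε]
    have h6 : (N₁ : ℝ) * (3 * δ) ≤ M * (3 * δ) :=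
      mul_le_mul_of_nonneg_right (by linarith) (by positivity)
    have hp' : (p : ℝ) = (1 + δ) / 2 := by rw [hδ]; ring
    rw [hp']
    linarith
  have h4 := measureReal_union_le (μ := parkingLaw p) (E₁ ∪ E₂) E₃
  have h5 := measureReal_union_le (μ := parkingLaw p) E₁ E₂
  have hc₁ : c ≤ 2 * (δ / 8) ^ 2 := min_le_left _ _
  have hc₂ : c ≤ 2 * ε ^ 2 := min_le_right _ _
  clear_value E₁ E₂ E₃ c ε δ n K M m
  have x₁ : Real.exp (-2 * (δ / 8) ^ 2 * M) ≤ Real.exp (-c * N) :=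
    exp_neg_two_sq_mul_le hN0.le hMN hc₁
  have x₂ : Real.exp (-2 * ε ^ 2 * (B * N : ℕ)) ≤ Real.exp (-c * N) :=
    exp_neg_two_sq_mul_le hN0.le (by push_cast; nlinarith) hc₂
  have x₃ := mul_le_mul_of_nonneg_left x₂ (by linarith : (0 : ℝ) ≤ m)
  calc _ ≤ _ := hmain
    _ ≤ _ := h4
    _ ≤ _ := add_le_add_left h5 _
    _ ≤ _ := add_le_add (add_le_add (e₁.trans x₁) (e₂.trans x₁)) (e₃.trans x₃)
    _ = _ := by ring

/-! ### From squares to all times, and removal of the prefactor -/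

lemma exists_measureReal_vacant_le_exp (hp : (1 / 2 : ℝ) < p) :
    ∃ C c : ℝ, 0 < c ∧ ∀ t : ℝ, 0 ≤ t →
      (parkingLaw p).real {ω | 0 ∈ (state ω ⌊t⌋₊).vacant} ≤ C * Real.exp (-c * Real.sqrt t) := by
  obtain ⟨C, c, g, N₀, hc, hg, h⟩ := exists_measureReal_vacant_sq_le p hp
  have hg' : (0 : ℝ) < g := by exact_mod_cast hg
  refine ⟨max (C * Real.exp c) (Real.exp (c * N₀)), c / g, by positivity, fun t ht => ?_⟩
  -- The largest `N` with `(g * N) ^ 2 ≤ t`; monotonicity of vacancy costs a factor `exp c` at most.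
  set N : ℕ := ⌊Real.sqrt t / g⌋₊
  have hlt : Real.sqrt t / g < N + 1 := Nat.lt_floor_add_one _
  rcases le_or_gt N₀ N with hN | hN
  · have hle : (N : ℝ) ≤ Real.sqrt t / g := Nat.floor_le (by positivity)
    have hsq : (g * N) ^ 2 ≤ ⌊t⌋₊ := by
      refine Nat.le_floor ?_
      rw [le_div_iff₀ hg'] at hle
      push_cast
      calc ((g : ℝ) * N) ^ 2 ≤ Real.sqrt t ^ 2 := by
            gcongr; linarith
        _ = t := Real.sq_sqrt ht
    have hv := h N hN
    have hC : 0 ≤ C := by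
      by_contra hC
      have := (measureReal_nonneg).trans hv
      nlinarith [Real.exp_pos (-c * N)]
    calc _ ≤ C * Real.exp (-c * N) := (measureReal_vacant_antitone p hsq).trans hv
      _ ≤ C * (Real.exp c * Real.exp (-(c / g) * Real.sqrt t)) := by
          rw [← Real.exp_add]
          gcongr
          have : c * (Real.sqrt t / g) ≤ c * (N + 1) := by gcongr
          have e : -(c / g) * Real.sqrt t = -(c * (Real.sqrt t / g)) := by ring
          rw [e]; linarith
      _ = C * Real.exp c * Real.exp (-(c / g) * Real.sqrt t) := by ring
      _ ≤ _ := by gcongr; exact le_max_left _ _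
  · have hN' : (N : ℝ) + 1 ≤ N₀ := by exact_mod_cast hN
    calc _ ≤ (1 : ℝ) := measureReal_le_one
      _ = Real.exp (c * N₀) * Real.exp (-(c * N₀)) := by rw [← Real.exp_add]; simp
      _ ≤ Real.exp (c * N₀) * Real.exp (-(c / g) * Real.sqrt t) := by
          gcongr
          have : c * (Real.sqrt t / g) ≤ c * N₀ := by gcongr; linarith
          have e : -(c / g) * Real.sqrt t = -(c * (Real.sqrt t / g)) := by ring
          rw [e]; linarith
      _ ≤ _ := by gcongr; exact le_max_right _ _

/-- The prefactor of an exponential bound can be absorbed into the exponent. -/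
lemma exists_exp_bound {f : ℝ → ℝ} {C c : ℝ} (hc : 0 < c) (h1 : ∀ t, f t ≤ 1 / 2)
    (h2 : ∀ t, 0 ≤ t → f t ≤ C * Real.exp (-c * Real.sqrt t)) :
    ∃ b : ℝ, 0 < b ∧ ∀ t : ℝ, 1 ≤ t → f t ≤ Real.exp (-b * Real.sqrt t) := by
  -- Beyond `r`, half of the exponent absorbs the prefactor; up to `r`, the bound `1 / 2 = exp (-log
  -- 2)` suffices.
  set r : ℝ := max 1 (2 * Real.log (max C 1) / c)
  have hr : 0 < r := lt_of_lt_of_le one_pos (le_max_left _ _)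
  have hlog : 0 < Real.log 2 := Real.log_pos (by norm_num)
  refine ⟨min (c / 2) (Real.log 2 / r), by positivity, fun t ht => ?_⟩
  have hs : 0 ≤ Real.sqrt t := Real.sqrt_nonneg t
  rcases le_or_gt (Real.sqrt t) r with hle | hgt
  · refine (h1 t).trans ?_
    rw [show (1 / 2 : ℝ) = Real.exp (-Real.log 2) by rw [Real.exp_neg, Real.exp_log two_pos]; norm_num]
    refine Real.exp_le_exp.2 ?_
    have : min (c / 2) (Real.log 2 / r) * Real.sqrt t ≤ Real.log 2 / r * r :=
      mul_le_mul (min_le_right _ _) hle hs (by positivity)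
    rw [div_mul_cancel₀ _ hr.ne'] at this
    linarith
  · have hC : (0 : ℝ) < max C 1 := lt_of_lt_of_le one_pos (le_max_right _ _)
    calc f t ≤ C * Real.exp (-c * Real.sqrt t) := h2 t (by linarith)
      _ ≤ max C 1 * Real.exp (-c * Real.sqrt t) := by gcongr; exact le_max_left _ _
      _ = Real.exp (Real.log (max C 1) + -c * Real.sqrt t) := by
          rw [Real.exp_add, Real.exp_log hC]
      _ ≤ _ := by
          refine Real.exp_le_exp.2 ?_
          have k1 : 2 * Real.log (max C 1) / c ≤ Real.sqrt t := (le_max_right _ _).trans hgt.le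
          rw [div_le_iff₀ hc] at k1
          have k2 : min (c / 2) (Real.log 2 / r) * Real.sqrt t ≤ c / 2 * Real.sqrt t :=
            mul_le_mul_of_nonneg_right (min_le_left _ _) hs
          linarith

/-! ### The lower bound -/

/-- The site constraints that keep the spot at the origin vacant until time `T`: spots within
distance `L`, and further away walks that do not visit the origin until time `T`. -/
def shield (L T : ℕ) (x : ℤ) : Set Site :=
  {s | (x.natAbs ≤ L → s.1 = -1) ∧
    (L < x.natAbs → ¬ ∃ k ≤ T, |displacement s.2.1 k| = (x.natAbs : ℤ))}

lemma measurableSet_displacement_abs_eq (T : ℕ) (z : ℤ) :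
    MeasurableSet {s | ∃ k ≤ T, |displacement s k| = z} := by
  simpa using measurableSet_exists_displacement T (fun y => |y| = z) fun _ => True

lemma shield_of_le {L T : ℕ} {x : ℤ} (hx : x.natAbs ≤ L) :
    shield L T x = (fun s : Site => s.1) ⁻¹' {-1} := by
  ext s
  simp [shield, hx, not_lt.2 hx]

lemma shield_of_lt {L T : ℕ} {x : ℤ} (hx : L < x.natAbs) :
    shield L T x =
      (fun s : Site => s.2.1) ⁻¹' {s | ∃ k ≤ T, |displacement s k| = (x.natAbs : ℤ)}ᶜ := by
  ext s
  simp only [shield, hx, not_le.2 hx, Set.mem_ofPred_eq, Set.mem_preimage, Set.mem_compl_iff,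
    false_imp_iff, true_and, true_imp_iff]

lemma measurableSet_shield (L T : ℕ) (x : ℤ) : MeasurableSet (shield L T x) := by
  rcases le_or_gt x.natAbs L with hx | hx
  · rw [shield_of_le hx]
    exact measurable_fst (measurableSet_singleton _)
  · rw [shield_of_lt hx]
    exact (measurePreserving_steps_of_site half).measurable
      (measurableSet_displacement_abs_eq T _).compl

lemma measureReal_shield_of_le {L T : ℕ} {x : ℤ} (hx : x.natAbs ≤ L) :
    (siteLaw p).real (shield L T x) = 1 - p := by
  rw [shield_of_le hx, (measurePreserving_type_of_site p).measureReal_preimage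
    (measurableSet_singleton _).nullMeasurableSet, signLaw_real_neg_one]

lemma one_sub_le_measureReal_shield {L T : ℕ} {x : ℤ} (hx : L < x.natAbs) :
    1 - (T : ℝ) / x.natAbs ^ 2 ≤ (siteLaw p).real (shield L T x) := by
  have hm := measurableSet_displacement_abs_eq T (x.natAbs : ℤ)
  rw [shield_of_lt hx, (measurePreserving_steps_of_site p).measureReal_preimage
    hm.compl.nullMeasurableSet, probReal_compl_eq_one_sub hm]
  have := measureReal_exists_abs_displacement_eq_le (x := (x.natAbs : ℤ)) (by omega) T
  rw [Int.cast_natCast] at this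
  linarith

/-- Vertices within `L` carry no car, those between `L` and `T` have walks avoiding the origin, and
those beyond `T` are too far to reach it in time. -/
lemma mem_vacant_of_shield {L T : ℕ} {ω : Config}
    (h : ω ∈ Set.pi (Finset.Icc (-(T : ℤ)) T : Finset ℤ) (shield L T)) :
    0 ∈ (state ω T).vacant := by
  rw [zero_mem_vacant_iff]
  refine ⟨(h 0 (by simp)).1 (by simp), ?_⟩
  rintro n hn ⟨v, hv, hv0⟩
  have hw := walk_mem_Icc ω v (n + 1)
  rw [hv0, Set.mem_Icc] at hw
  have hvS := h v (by simp only [Finset.coe_Icc, Set.mem_Icc]; omega)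
  rcases le_or_gt v.natAbs L with hL | hL
  · exact not_isCar_and_isSpot ω v ⟨isCar_of_mem_unparked hv.1, hvS.1 hL⟩
  · refine hvS.2 hL ⟨n + 1, hn, ?_⟩
    rw [walk_eq] at hv0
    have : displacement (ω v).2.1 (n + 1) = -v := by omega
    rw [this, abs_neg, Int.abs_eq_natAbs]

lemma exp_neg_two_mul_le_one_sub {y : ℝ} (h0 : 0 ≤ y) (h1 : y ≤ 1 / 2) :
    Real.exp (-(2 * y)) ≤ 1 - y := by
  rw [Real.exp_neg, inv_le_comm₀ (Real.exp_pos _) (by linarith)]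
  refine le_trans ?_ (Real.add_one_le_exp (2 * y))
  rw [inv_le_iff_one_le_mul₀ (by linarith)]
  nlinarith

lemma sum_Icc_natAbs_le {u : ℕ → ℝ} (hu : ∀ i, 0 ≤ u i) (T : ℕ) :
    ∑ x ∈ Finset.Icc (-(T : ℤ)) T, u x.natAbs ≤ 2 * ∑ i ∈ Finset.range (T + 1), u i := by
  induction T with
  | zero => simp; linarith [hu 0]
  | succ T ih =>
    have e : Finset.Icc (-((T + 1 : ℕ) : ℤ)) ((T + 1 : ℕ) : ℤ) =
        insert ((T : ℤ) + 1) (insert (-((T : ℤ) + 1)) (Finset.Icc (-(T : ℤ)) T)) := by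
      ext x; simp only [Finset.mem_insert, Finset.mem_Icc]; omega
    rw [e, Finset.sum_insert, Finset.sum_insert, Finset.sum_range_succ]
    · have h1 : ((T : ℤ) + 1).natAbs = T + 1 := by omega
      have h2 : (-((T : ℤ) + 1)).natAbs = T + 1 := by omega
      rw [h1, h2]
      linarith
    · simp
    · simp only [Finset.mem_insert, Finset.mem_Icc]; omega

lemma sum_range_ite_le {lam : ℝ} (hlam : 0 ≤ lam) (L T : ℕ) :
    ∑ i ∈ Finset.range (T + 1), (if i ≤ L then lam else 2 * ((T : ℝ) / i ^ 2)) ≤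
      (L + 1) * lam + 4 * T / (L + 1) := by
  rw [Finset.sum_ite]
  refine add_le_add ?_ ?_
  · rw [Finset.sum_const, nsmul_eq_mul]
    refine mul_le_mul_of_nonneg_right ?_ hlam
    have : ((Finset.range (T + 1)).filter fun i => i ≤ L) ⊆ Finset.range (L + 1) := by
      intro i hi
      simp only [Finset.mem_filter, Finset.mem_range] at hi ⊢
      omega
    have := Finset.card_le_card this
    rw [Finset.card_range] at this
    exact_mod_cast this
  · have e : ((Finset.range (T + 1)).filter fun i => ¬ i ≤ L) = Finset.Ioo L (T + 1) := by
      ext i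
      simp only [Finset.mem_filter, Finset.mem_range, Finset.mem_Ioo]
      omega
    rw [e]
    calc ∑ i ∈ Finset.Ioo L (T + 1), 2 * ((T : ℝ) / i ^ 2) =
        2 * T * ∑ i ∈ Finset.Ioo L (T + 1), ((i : ℝ) ^ 2)⁻¹ := by
          rw [Finset.mul_sum]
          exact Finset.sum_congr rfl fun i _ => by rw [div_eq_mul_inv]; ring
      _ ≤ 2 * T * (2 / (L + 1)) := by
          gcongr
          exact sum_Ioo_inv_sq_le L (T + 1)
      _ = 4 * T / (L + 1) := by ring

/-- The constraints concern distinct sites, so probabilities multiply. A far factor `1 - y` is at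
least `exp (-2y)` for `y ≤ 1 / 2`, which is what `hLT` ensures. -/
lemma exp_neg_le_measureReal_vacant {L T : ℕ} (hp : (p : ℝ) < 1)
    (hLT : 2 * (T : ℝ) ≤ (L + 1) ^ 2) :
    Real.exp (-(2 * ((L + 1) * (-Real.log (1 - p)) + 4 * T / (L + 1)))) ≤
      (parkingLaw p).real {ω | 0 ∈ (state ω T).vacant} := by
  set lam := -Real.log (1 - p) with hlam
  have hlam0 : 0 ≤ lam := by
    rw [hlam, neg_nonneg]
    exact Real.log_nonpos (by linarith) (by linarith [p.2.1])
  set u : ℕ → ℝ := fun i => if i ≤ L then lam else 2 * ((T : ℝ) / i ^ 2) with hu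
  have hu0 : ∀ i, 0 ≤ u i := fun i => by
    simp only [hu]
    split_ifs
    · exact hlam0
    · positivity
  have hsite : ∀ x : ℤ, Real.exp (-u x.natAbs) ≤ (siteLaw p).real (shield L T x) := by
    intro x
    rcases le_or_gt x.natAbs L with hx | hx
    · rw [measureReal_shield_of_le p hx]
      simp only [hu, hx, if_true, hlam, neg_neg]
      rw [Real.exp_log (by linarith)]
    · refine le_trans ?_ (one_sub_le_measureReal_shield p hx)
      simp only [hu, not_le.2 hx, if_false]
      refine exp_neg_two_mul_le_one_sub (by positivity) ?_
      have h1 : (L : ℝ) + 1 ≤ x.natAbs := by exact_mod_cast hx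
      have h2 : (0 : ℝ) < x.natAbs := by linarith [(Nat.cast_nonneg L : (0 : ℝ) ≤ L)]
      rw [div_le_div_iff₀ (by positivity) two_pos]
      have : ((L : ℝ) + 1) ^ 2 ≤ (x.natAbs : ℝ) ^ 2 := by gcongr
      linarith
  have hpi : (parkingLaw p).real (Set.pi (Finset.Icc (-(T : ℤ)) T : Finset ℤ) (shield L T)) =
      ∏ x ∈ Finset.Icc (-(T : ℤ)) T, (siteLaw p).real (shield L T x) := by
    rw [measureReal_def, parkingLaw, Measure.infinitePi_pi _ fun x _ => measurableSet_shield L T x,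
      ENNReal.toReal_prod]
    rfl
  calc _ ≤ Real.exp (∑ x ∈ Finset.Icc (-(T : ℤ)) T, -u x.natAbs) := by
        refine Real.exp_le_exp.2 ?_
        rw [Finset.sum_neg_distrib]
        have h1 := sum_Icc_natAbs_le hu0 T
        have h2 := sum_range_ite_le hlam0 L T
        linarith
    _ = ∏ x ∈ Finset.Icc (-(T : ℤ)) T, Real.exp (-u x.natAbs) := Real.exp_sum _ _
    _ ≤ ∏ x ∈ Finset.Icc (-(T : ℤ)) T, (siteLaw p).real (shield L T x) :=
        Finset.prod_le_prod (fun x _ => (Real.exp_pos _).le) fun x _ => hsite x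
    _ = _ := hpi.symm
    _ ≤ _ := measureReal_mono (fun ω hω => mem_vacant_of_shield hω) (measure_ne_top _ _)

lemma exists_exp_neg_le_measureReal_vacant (hp : (p : ℝ) < 1) :
    ∃ a : ℝ, 0 < a ∧ ∀ t : ℝ, 1 ≤ t → Real.exp (-a * Real.sqrt t) ≤
      (parkingLaw p).real {ω | 0 ∈ (state ω ⌊t⌋₊).vacant} := by
  have hlam : 0 ≤ -Real.log (1 - p) := by
    rw [neg_nonneg]
    exact Real.log_nonpos (by linarith) (by linarith [p.2.1])
  refine ⟨8 * (-Real.log (1 - p)) + 4, by positivity, fun t ht => ?_⟩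
  set r := Real.sqrt t
  have hr1 : 1 ≤ r := Real.one_le_sqrt.2 ht
  have hrt : r ^ 2 = t := Real.sq_sqrt (by linarith)
  -- Large enough for `hLT`, and since `r ≥ 1` also `L + 1 ≤ 4 * r`, so both terms of the exponent
  -- are of order `√t`.
  set L : ℕ := ⌈2 * r⌉₊
  have hL1 : 2 * r ≤ L := Nat.le_ceil _
  have hL2 : (L : ℝ) < 2 * r + 1 := Nat.ceil_lt_add_one (by linarith)
  have hT : (⌊t⌋₊ : ℝ) ≤ r ^ 2 := hrt ▸ Nat.floor_le (by linarith)
  refine le_trans (Real.exp_le_exp.2 ?_) (exp_neg_le_measureReal_vacant p (L := L) hp (by nlinarith))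
  have h1 : 4 * (⌊t⌋₊ : ℝ) / (L + 1) ≤ 2 * r := by
    rw [div_le_iff₀ (by linarith)]
    nlinarith
  have h2 : ((L : ℝ) + 1) * (-Real.log (1 - p)) ≤ 4 * r * (-Real.log (1 - p)) :=
    mul_le_mul_of_nonneg_right (by linarith) hlam
  linarith

end Parking

end

theorem theorem1p2 (p : unitInterval) (hp : (1 / 2 : ℝ) < (p : ℝ)) :
    (∃ b : ℝ, 0 < b ∧ ∀ t : ℝ, 1 ≤ t →
      (Parking.parkingLaw p).real {ω | ENNReal.ofReal t < (Parking.sigma ω : ℝ≥0∞)} ≤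
        Real.exp (-b * Real.sqrt t)) ∧
    ((p : ℝ) < 1 → ∃ a : ℝ, 0 < a ∧ ∀ t : ℝ, 1 ≤ t →
      Real.exp (-a * Real.sqrt t) ≤
        (Parking.parkingLaw p).real {ω | ENNReal.ofReal t < (Parking.sigma ω : ℝ≥0∞)}) := by
  have hset : ∀ t : ℝ, 1 ≤ t → {ω | ENNReal.ofReal t < (Parking.sigma ω : ℝ≥0∞)} =
      {ω | 0 ∈ (Parking.state ω ⌊t⌋₊).vacant} := fun t ht =>
    Set.ext fun ω => Parking.lt_sigma_iff ω (by linarith)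
  constructor
  -- A vacant origin was initially a spot, an event of probability `1 - p < 1 / 2`; this uniform gap
  -- below one lets the prefactor be absorbed.
  · have h1 : ∀ t : ℝ, (Parking.parkingLaw p).real {ω | 0 ∈ (Parking.state ω ⌊t⌋₊).vacant} ≤
        1 / 2 := fun t =>
      (Parking.measureReal_vacant_antitone p (Nat.zero_le _)).trans
        ((Parking.measureReal_isSpot p 0).trans_le (by linarith))
    obtain ⟨C, c, hc, h⟩ := Parking.exists_measureReal_vacant_le_exp p hp
    obtain ⟨b, hb, hbt⟩ := Parking.exists_exp_bound hc h1 h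
    exact ⟨b, hb, fun t ht => by rw [hset t ht]; exact hbt t ht⟩
  · intro hp1
    obtain ⟨a, ha, h⟩ := Parking.exists_exp_neg_le_measureReal_vacant p hp1
    exact ⟨a, ha, fun t ht => by rw [hset t ht]; exact h t ht⟩
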